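/- Let $A$ be a finite-dimensional commutative associative algebra with unit over $\mathbb{C}$ with its usual (Hausdorff vector space) topology, let $\mathcal{I}_1,\dots,\mathcal{I}_m$ be its maximal ideals, and let $f_u:A\to\mathbb{C}$ be the multiplicative linear functional with kernel $\mathcal{I}_u$ ($f_u(1)=1$); these are all the unital algebra homomorphisms $A\to\mathbb{C}$. Let $e_1=1,e_2,\dots,e_k\in A$, $k\ge 2$, be linearly independent over $\mathbb{R}$, let $E_k=\{\sum_{j=1}^k x_je_j: x_j\in\mathbb{R}\}$, identified with the Euclidean space $\mathbb{R}^k$ through the coordinates $x_j$ (topology, rectifiability and circles in $E_k$ are those of $\mathbb{R}^k$), and let $M_u=\{\zeta\in E_k: f_u(\zeta)=0\}$. Assume that $f_u(E_k)=\mathbb{C}$ for all $u=1,\dots,m$. Let $\Omega\subset E_k$ be a domain that is convex with respect to the sets of directions $M_u$: for every $u$, $\Omega$ contains the segment between $\zeta_1$ and $\zeta_2$ whenever $\zeta_1,\zeta_2\in\Omega$ and $\zeta_2-\zeta_1\in M_u$. Let $\Phi:\Omega\to A$ be monogenic, i.e. continuous and such that for each $\zeta\in\Omega$ there is $\Phi'(\zeta)\in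 A$ with $\lim_{\varepsilon\to0+}(\Phi(\zeta+\varepsilon h)-\Phi(\zeta))\varepsilon^{-1}=h\,\Phi'(\zeta)$ for all $h\in E_k$. Let $\zeta_0\in\Omega$, let $S=\{\zeta\in E_k:\zeta-\zeta_0\in\bigcup_{u=1}^m M_u\}$, and let $\gamma$ be a closed rectifiable Jordan curve in $\Omega$ that embraces $S$ once. This means that in some two-dimensional plane through $\zeta_0$ there is a (once traversed) circle $C(\zeta_0,\varepsilon)$ with centre $\zeta_0$ and radius $\varepsilon>0$ such that (i) $C(\zeta_0,\varepsilon)$ is contained in $\Omega$ together with the closed disc that it bounds in its plane; (ii) for each $u$ the image of $C(\zeta_0,\varepsilon)$ under $f_u$ is the boundary of a bounded domain of $\mathbb{C}$ that contains $f_u(\zeta_0)$; (iii) $\gamma$ is homotopic to $C(\zeta_0,\varepsilon)$, through closed curves, in $\Omega\setminus S$. Then, for every such circle, with $C(0,\varepsilon)=C(\zeta_0,\varepsilon)-\zeta_0$ its translate (with the same orientation) and with $\int_\gamma\Psi(\zeta)\,d\zeta$ the limit of the Riemann–Stieltjes sums $\sum_i\Psi(\zeta(\tau_i))(\zeta(t_{i+1})-\zeta(t_i))$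 as the mesh of the partition tends to zero, the integrals below exist and $$\lambda\,\Phi(\zeta_0)=\int_\gamma\Phi(\zeta)(\zeta-\zeta_0)^{-1}\,d\zeta,\qquad \lambda:=\int_{C(0,\varepsilon)}\zeta^{-1}\,d\zeta .$$ -/

import Mathlib

open Set Filter Topology

namespace CauchyFormula

/-- `ℝ^k` with its Euclidean norm; it carries the topology and the metric of `E_k`. -/
abbrev Coord (k : ℕ) : Type := EuclideanSpace ℝ (Fin k)

section Algebra

variable {A : Type*} [CommRing A] [Algebra ℂ A] {k : ℕ}

/-- The element `ζ = ∑ x_j e_j` of `E_k` with real coordinates `x`.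
Subsets of, curves in and functions on `E_k` are given in these coordinates. -/
def point (e : Fin k → A) (x : Coord k) : A := ∑ j, x j • e j

/-- The points `ζ` of `E_k` with `ζ - ζ₀ ∈ ⋃ M_u`, where `M_u = {ζ ∈ E_k : f_u(ζ) = 0}` and
`f_u` runs over the multiplicative linear functionals `A → ℂ` (one for each maximal ideal). -/
def singularSet (e : Fin k → A) (x₀ : Coord k) : Set (Coord k) :=
  {x | ∃ f : A →ₐ[ℂ] ℂ, f (point e x - point e x₀) = 0}

/-- `Ω` is convex with respect to the sets of directions `M_u`, for all `u`. -/
def ConvexAlongDirections (e : Fin k → A) (Ω : Set (Coord k)) : Prop :=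
  ∀ f : A →ₐ[ℂ] ℂ, ∀ x ∈ Ω, ∀ y ∈ Ω, f (point e y - point e x) = 0 → segment ℝ x y ⊆ Ω

/-- Monogenic function in `Ω`: continuous, with a Gateaux derivative `d = Φ'(ζ) ∈ A` at each
point. -/
def Monogenic [TopologicalSpace A] (e : Fin k → A) (Ω : Set (Coord k)) (Φ : Coord k → A) :
    Prop :=
  ContinuousOn Φ Ω ∧ ∀ x ∈ Ω, ∃ d : A, ∀ h : Coord k,
    Tendsto (fun ε : ℝ => ε⁻¹ • (Φ (x + ε • h) - Φ x)) (𝓝[>] 0) (𝓝 (point e h * d))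

/-- `∫_γ Ψ(ζ) dζ` exists and equals `I`, for a curve `γ` parametrized by `[0, 1]`: the
Riemann–Stieltjes sums `∑ Ψ(ζ(τ_i)) (ζ(t_{i+1}) - ζ(t_i))`, where `ζ(t) = ∑ γ_j(t) e_j`,
converge to `I` as the mesh of the tagged partition tends to zero. -/
def HasCurveIntegral [TopologicalSpace A] (e : Fin k → A) (γ : ℝ → Coord k)
    (Ψ : Coord k → A) (I : A) : Prop :=
  ∀ U ∈ 𝓝 I, ∃ δ > (0 : ℝ), ∀ (N : ℕ) (t τ : ℕ → ℝ), t 0 = 0 → t N = 1 →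
    (∀ i < N, t i ≤ τ i ∧ τ i ≤ t (i + 1) ∧ t (i + 1) - t i < δ) →
    ∑ i ∈ Finset.range N, Ψ (γ (τ i)) * (point e (γ (t (i + 1))) - point e (γ (t i))) ∈ U

end Algebra

section Curves

variable {k : ℕ}

/-- Closed rectifiable Jordan curve, parametrized by `[0, 1]`. -/
structure IsClosedRectifiableJordan (γ : ℝ → Coord k) : Prop where
  continuousOn : ContinuousOn γ (Icc 0 1)
  closed : γ 0 = γ 1
  injOn : InjOn γ (Ico 0 1)
  rectifiable : BoundedVariationOn γ (Icc 0 1)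

/-- The closed curves `γ₀`, `γ₁`, parametrized by `[0, 1]`, are homotopic in `U` through
closed curves. -/
def ClosedHomotopicIn (U : Set (Coord k)) (γ₀ γ₁ : ℝ → Coord k) : Prop :=
  ∃ H : ℝ × ℝ → Coord k,
    ContinuousOn H (Icc 0 1 ×ˢ Icc 0 1) ∧ MapsTo H (Icc 0 1 ×ˢ Icc 0 1) U ∧
    (∀ t ∈ Icc (0 : ℝ) 1, H (0, t) = γ₀ t) ∧ (∀ t ∈ Icc (0 : ℝ) 1, H (1, t) = γ₁ t) ∧
    ∀ s ∈ Icc (0 : ℝ) 1, H (s, 0) = H (s, 1)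

/-- The circle with centre `x₀` and radius `ε` in the plane `x₀ + span {a, b}`, for an
orthonormal pair `a, b`, run through once by `t ∈ [0, 1]`. -/
noncomputable def circle (x₀ a b : Coord k) (ε : ℝ) (t : ℝ) : Coord k :=
  x₀ + ε • (Real.cos (2 * Real.pi * t) • a + Real.sin (2 * Real.pi * t) • b)

end Curves

/-- The circle `C(ζ₀, ε)` in the plane `ζ₀ + span {a, b}`, which lies in `Ω` together with the
disc that it bounds, embraces `{ζ : ζ - ζ₀ ∈ ⋃ M_u}`: for each `u` its image under `f_u` bounds
a domain `D` of the complex plane with `f_u(ζ₀) ∈ D`. -/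
structure IsEmbracingCircle {A : Type*} [CommRing A] [Algebra ℂ A] {k : ℕ} (e : Fin k → A)
    (Ω : Set (Coord k)) (x₀ a b : Coord k) (ε : ℝ) : Prop where
  radius_pos : 0 < ε
  orthonormal : Orthonormal ℝ ![a, b]
  disc_subset : {x | x - x₀ ∈ Submodule.span ℝ {a, b} ∧ ‖x - x₀‖ ≤ ε} ⊆ Ω
  embraces : ∀ f : A →ₐ[ℂ] ℂ, ∃ D : Set ℂ, IsOpen D ∧ IsConnected D ∧ Bornology.IsBounded D ∧
    frontier D = (fun t => f (point e (circle x₀ a b ε t))) '' Icc 0 1 ∧ f (point e x₀) ∈ D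

end CauchyFormula
/-!
The inverse of `ζ - ζ₀` is differentiable along `E_k` wherever `ζ - ζ₀` is invertible, which by
Gelfand's theory is the case off `S`. So it suffices to integrate functions `Ψ` that are continuous
and have a directional derivative `h * Ψ'` in every direction `h`, with no assumption on `Ψ'`. Over
a triangle `∫ Ψ dζ` vanishes by a theorem of Looman–Menchoff type: the pull-back of `Ψ dζ` to a
rectangle is closed off an exceptional compact set, and by Baire's theorem the partial increments
are uniformly Lipschitz on a piece of that set, where Fubini and Lebesgue density make the form
closed after all. Local primitives then make `∫ Ψ dζ` invariant under homotopies of closed curves.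

Hence `γ` may be replaced by the circle with radius `ε`, and this by the one with radius `r * ε` for
any `0 < r ≤ 1`. The factors `r` of `dζ` and of `ζ - ζ₀` cancel, so the integral becomes that of
`Φ (ζ₀ + r ζ) * ζ⁻¹ dζ` over `C(0, ε)`, which tends to `λ Φ(ζ₀)` as `r → 0`.
-/

namespace CauchyFormula

open MeasureTheory Metric
open scoped NNReal

section Slices

theorem ae_accPt {X : Type*} [TopologicalSpace X] [SecondCountableTopology X] [MeasurableSpace X]
    (μ : Measure X) [NullSingletonClass μ] (S : Set X) : ∀ᵐ x ∂μ, x ∈ S → AccPt x (𝓟 S) := by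
  have hnull : μ {x | x ∈ S ∧ ¬AccPt x (𝓟 S)} = 0 := by
    refine measure_null_of_locally_null _ fun x hx => ⟨{x}, ?_, measure_singleton x⟩
    simp only [accPt_iff_nhds, not_forall, not_exists, not_and, not_not] at hx
    obtain ⟨-, U, hU, hUS⟩ := hx
    exact mem_nhdsWithin_iff_exists_mem_nhds_inter.2 ⟨U, hU, fun z hz => hUS z ⟨hz.1, hz.2.1⟩⟩
  rw [ae_iff]
  simpa only [Classical.not_imp] using hnull

theorem ae_deriv_eq_of_eqOn {𝕜 F : Type*} [NontriviallyNormedField 𝕜]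
    [SecondCountableTopology 𝕜] [MeasurableSpace 𝕜] {μ : Measure 𝕜} [NullSingletonClass μ]
    [NormedAddCommGroup F] [NormedSpace 𝕜 F] {f g g' : 𝕜 → F} {S : Set 𝕜} (hfg : EqOn f g S)
    (hf : ∀ᵐ x ∂μ, DifferentiableAt 𝕜 f x) (hg : ∀ x ∈ S, HasDerivWithinAt g (g' x) S x) :
    ∀ᵐ x ∂μ, x ∈ S → deriv f x = g' x := by
  filter_upwards [ae_accPt μ S, hf] with x hacc hfx hxS
  have hfx' : HasDerivWithinAt g (deriv f x) S x :=
    hfx.hasDerivAt.hasDerivWithinAt.congr (fun y hy => (hfg hy).symm) (hfg hxS).symm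
  exact (uniqueDiffWithinAt_iff_accPt.2 (hacc hxS)).eq_deriv _ hfx' (hg x hxS)

variable {f g g' : ℝ → ℝ} {S : Set ℝ} {a b : ℝ} {N : ℝ≥0}

theorem abs_sub_sub_setIntegral_deriv_le (hf : LipschitzWith N f) (hab : a ≤ b)
    (hS : MeasurableSet S) (hSab : S ⊆ Icc a b) :
    |f b - f a - ∫ y in S, deriv f y| ≤ N * volume.real (Ioc a b \ S) := by
  have hbound : ∀ y, ‖deriv f y‖ ≤ N := fun y => norm_deriv_le_of_lipschitz hf
  have hint : IntegrableOn (deriv f) (Ioc a b) :=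
    IntegrableOn.of_bound measure_Ioc_lt_top (measurable_deriv f).aestronglyMeasurable N
      (Eventually.of_forall hbound)
  have hSae : (Ioc a b ∩ S : Set ℝ) =ᵐ[volume] S := by
    conv_rhs => rw [← inter_eq_right.2 hSab]
    exact Ioc_ae_eq_Icc.inter (EventuallyEq.refl _ S)
  have hincr : f b - f a = (∫ y in S, deriv f y) + ∫ y in Ioc a b \ S, deriv f y := by
    rw [← (hf.lipschitzOnWith (s := uIcc a b)).absolutelyContinuousOnInterval.integral_deriv_eq_sub,
      intervalIntegral.integral_of_le hab, ← integral_inter_add_sdiff hS hint,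
      setIntegral_congr_set hSae]
  rw [hincr, add_sub_cancel_left, ← Real.norm_eq_abs]
  exact norm_setIntegral_le_of_norm_le_const ((measure_mono sdiff_subset).trans_lt
    measure_Ioc_lt_top) fun y _ => hbound y

theorem lipschitzOnWith_insert {X Y : Type*} [PseudoMetricSpace X] [PseudoMetricSpace Y] {K : ℝ≥0}
    {f : X → Y} {s : Set X} {x : X} (hs : LipschitzOnWith K f s)
    (hx : ∀ y ∈ s, dist (f x) (f y) ≤ K * dist x y) : LipschitzOnWith K f (insert x s) := by
  refine LipschitzOnWith.of_dist_le_mul fun y hy z hz => ?_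
  rcases hy with rfl | hy <;> rcases hz with rfl | hz
  · simp
  · exact hx z hz
  · simpa only [dist_comm] using hx y hy
  · exact hs.dist_le_mul y hy z hz

theorem lipschitzOnWith_insert_endpoints (hab : a ≤ b) (hSab : S ⊆ Icc a b) (hne : S.Nonempty)
    (hg : ∀ y ∈ S, ∀ y' ∈ Icc a b, |g y' - g y| ≤ N * |y' - y|) :
    LipschitzOnWith N g (insert a (insert b S)) := by
  have ha : a ∈ Icc a b := left_mem_Icc.2 hab
  have hb : b ∈ Icc a b := right_mem_Icc.2 hab
  have hends : |g a - g b| ≤ N * |a - b| := by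
    obtain ⟨c, hc⟩ := hne
    calc |g a - g b| ≤ |g a - g c| + |g c - g b| := abs_sub_le _ _ _
      _ ≤ N * |a - c| + N * |b - c| :=
        add_le_add (hg c hc a ha) (abs_sub_comm (g b) (g c) ▸ hg c hc b hb)
      _ = N * |a - b| := by
        rw [abs_of_nonneg (sub_nonneg.2 (hSab hc).2), abs_of_nonpos (sub_nonpos.2 (hSab hc).1),
          abs_of_nonpos (sub_nonpos.2 hab)]
        ring
  have hS : LipschitzOnWith N g S :=
    LipschitzOnWith.of_dist_le_mul fun y hy z hz => hg z hz y (hSab hy)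
  refine lipschitzOnWith_insert (lipschitzOnWith_insert hS fun y hy => hg y hy b hb) ?_
  rintro y (rfl | hy)
  · exact hends
  · exact hg y hy a ha

theorem abs_sub_sub_setIntegral_le (hab : a ≤ b) (hS : MeasurableSet S) (hSab : S ⊆ Icc a b)
    (hne : S.Nonempty) (hg' : ∀ y ∈ S, HasDerivAt g (g' y) y)
    (hg : ∀ y ∈ S, ∀ y' ∈ Icc a b, |g y' - g y| ≤ N * |y' - y|) :
    |g b - g a - ∫ y in S, g' y| ≤ N * volume.real (Ioc a b \ S) := by
  obtain ⟨f, hf, hgf⟩ := (lipschitzOnWith_insert_endpoints hab hSab hne hg).extend_real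
  have hae : ∀ᵐ y, y ∈ S → deriv f y = g' y :=
    ae_deriv_eq_of_eqOn (fun y hy => (hgf (by simp [hy])).symm) hf.ae_differentiableAt
      fun y hy => (hg' y hy).hasDerivWithinAt
  rw [hgf (by simp), hgf (by simp), ← setIntegral_congr_ae hS hae]
  exact abs_sub_sub_setIntegral_deriv_le hf hab hS hSab

end Slices

section Rectangles

theorem integral_indicator_slice {α β E : Type*} [MeasurableSpace α] [MeasurableSpace β]
    [NormedAddCommGroup E] [NormedSpace ℝ E] {ν : Measure β} {F : Set (α × β)}
    (hF : MeasurableSet F) (f : α × β → E) (x : α) :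
    ∫ y, F.indicator f (x, y) ∂ν = ∫ y in Prod.mk x ⁻¹' F, f (x, y) ∂ν := by
  rw [← integral_indicator (measurable_prodMk_left hF)]
  rfl

theorem integrable_setIntegral_slice {E : Type*} [NormedAddCommGroup E] [NormedSpace ℝ E]
    {F : Set (ℝ × ℝ)} {f : ℝ × ℝ → E} (hF : MeasurableSet F) (hf : IntegrableOn f F) :
    Integrable fun x => ∫ y in Prod.mk x ⁻¹' F, f (x, y) := by
  rw [← integrable_indicator_iff hF, Measure.volume_eq_prod] at hf
  simpa only [integral_indicator_slice hF] using hf.integral_prod_left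

theorem setIntegral_eq_integral_slices {E : Type*} [NormedAddCommGroup E] [NormedSpace ℝ E]
    {F : Set (ℝ × ℝ)} {f : ℝ × ℝ → E} {a b : ℝ} (hab : a ≤ b) (hF : MeasurableSet F)
    (hFab : MapsTo Prod.fst F (Icc a b)) (hf : IntegrableOn f F) :
    ∫ z in F, f z = ∫ x in a..b, ∫ y in Prod.mk x ⁻¹' F, f (x, y) := by
  have hempty : ∀ x ∉ Icc a b, Prod.mk x ⁻¹' F = ∅ := fun x hx =>
    eq_empty_of_forall_notMem fun y hy => hx (hFab hy)
  rw [← integrable_indicator_iff hF, Measure.volume_eq_prod] at hf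
  rw [← integral_indicator hF, Measure.volume_eq_prod, integral_prod _ hf,
    intervalIntegral.integral_of_le hab, ← integral_Icc_eq_integral_Ioc]
  simp only [integral_indicator_slice hF]
  exact (setIntegral_eq_integral_of_forall_compl_eq_zero fun x hx => by
    rw [hempty x hx, setIntegral_empty]).symm

/-- The points from which `w` is Lipschitz along the two axes, with constant `N` at distances up
to `δ`. Baire's theorem applies to these closed sets in the proof of the Looman–Menchoff
theorem. -/
def axisLipschitz (w : ℝ × ℝ → ℝ) (N : ℝ≥0) (δ : ℝ) : Set (ℝ × ℝ) :=
  {z | ∀ h : ℝ, |h| ≤ δ →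
    |w (z.1 + h, z.2) - w z| ≤ N * |h| ∧ |w (z.1, z.2 + h) - w z| ≤ N * |h|}

variable {w D : ℝ × ℝ → ℝ} {F : Set (ℝ × ℝ)} {a₁ b₁ a₂ b₂ A₁ B₁ A₂ B₂ p q δ κ : ℝ} {N : ℝ≥0}

theorem isClosed_axisLipschitz (hw : Continuous w) (N : ℝ≥0) (δ : ℝ) :
    IsClosed (axisLipschitz w N δ) := by
  simp only [axisLipschitz, ofPred_forall, ofPred_and]
  refine isClosed_iInter fun h => isClosed_iInter fun _ => IsClosed.inter ?_ ?_ <;>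
    exact isClosed_le (by fun_prop) continuous_const

theorem axisLipschitz_comp_swap (w : ℝ × ℝ → ℝ) (N : ℝ≥0) (δ : ℝ) :
    axisLipschitz (w ∘ Prod.swap) N δ = Prod.swap ⁻¹' axisLipschitz w N δ := by
  ext z
  simp only [axisLipschitz, Function.comp_apply, Prod.swap, mem_preimage, mem_ofPred_eq]
  exact forall₂_congr fun h _ => and_comm

theorem abs_sub_fst_le_of_mem_axisLipschitz {z : ℝ × ℝ} (hz : z ∈ axisLipschitz w N δ) {x : ℝ}
    (hx : |x - z.1| ≤ δ) : |w (x, z.2) - w z| ≤ N * |x - z.1| := by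
  simpa using (hz (x - z.1) hx).1

theorem abs_sub_snd_le_of_mem_axisLipschitz {z : ℝ × ℝ} (hz : z ∈ axisLipschitz w N δ) {y : ℝ}
    (hy : |y - z.2| ≤ δ) : |w (z.1, y) - w z| ≤ N * |y - z.2| := by
  simpa using (hz (y - z.2) hy).2

theorem abs_deriv_snd_le_of_mem_axisLipschitz {z : ℝ × ℝ} {d : ℝ} (hδ : 0 < δ)
    (hz : z ∈ axisLipschitz w N δ) (hd : HasDerivAt (fun y => w (z.1, y)) d z.2) : |d| ≤ N := by
  refine hd.le_of_lip' N.2 ?_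
  filter_upwards [closedBall_mem_nhds z.2 hδ] with y hy
  exact abs_sub_snd_le_of_mem_axisLipschitz hz hy

theorem integrableOn_of_hasDerivAt_snd (hw : Continuous w) (hF : IsCompact F) (hδ : 0 < δ)
    (hFw : F ⊆ axisLipschitz w N δ) (hd : ∀ z ∈ F, HasDerivAt (fun y => w (z.1, y)) (D z) z.2) :
    IntegrableOn D F := by
  have hmeas : Measurable fun z : ℝ × ℝ => deriv (Function.curry w z.1) z.2 :=
    measurable_deriv_with_param (by simpa using hw)
  have hderiv : ∀ᵐ z ∂volume.restrict F, deriv (Function.curry w z.1) z.2 = D z :=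
    (ae_restrict_mem hF.measurableSet).mono fun z hz => (hd z hz).deriv
  exact IntegrableOn.of_bound hF.measure_lt_top (hmeas.aestronglyMeasurable.congr hderiv) N
    ((ae_restrict_mem hF.measurableSet).mono fun z hz =>
      abs_deriv_snd_le_of_mem_axisLipschitz hδ (hFw hz) (hd z hz))

theorem abs_sub_le_of_mem_axisLipschitz (hp : (p, b₂) ∈ axisLipschitz w N δ)
    (hq : (q, a₂) ∈ axisLipschitz w N δ) {x : ℝ} (hxp : |x - p| ≤ δ) (hxq : |x - q| ≤ δ)
    (hpq : |p - q| ≤ δ) (hab : |a₂ - b₂| ≤ δ) :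
    |w (x, b₂) - w (x, a₂)| ≤ N * (|x - p| + |a₂ - b₂| + |p - q| + |x - q|) := by
  have h₁ := abs_sub_fst_le_of_mem_axisLipschitz hp hxp
  have h₂ := abs_sub_snd_le_of_mem_axisLipschitz hp hab
  have h₃ := abs_sub_fst_le_of_mem_axisLipschitz hq hpq
  have h₄ := abs_sub_fst_le_of_mem_axisLipschitz hq hxq
  rw [mul_add, mul_add, mul_add]
  rw [abs_le] at *
  constructor <;> linarith

theorem abs_sub_sub_setIntegral_slice_le (hF : MeasurableSet F) (hFw : F ⊆ axisLipschitz w N δ)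
    (hFR : F ⊆ Icc a₁ b₁ ×ˢ Icc a₂ b₂) (hA₁ : A₁ ≤ a₁) (hB₁ : b₁ ≤ B₁) (hA₂ : A₂ ≤ a₂)
    (hB₂ : b₂ ≤ B₂) (hδ₁ : B₁ - A₁ ≤ δ) (hδ₂ : B₂ - A₂ ≤ δ) (hκ₀ : 0 ≤ κ)
    (hκ : B₁ - A₁ ≤ κ * (B₂ - A₂)) (hp : (p, b₂) ∈ F) (hq : (q, a₂) ∈ F)
    (hd : ∀ z ∈ F, HasDerivAt (fun y => w (z.1, y)) (D z) z.2) {x : ℝ} (hx : x ∈ Icc a₁ b₁) :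
    |w (x, b₂) - w (x, a₂) - ∫ y in Prod.mk x ⁻¹' F, D (x, y)| ≤
      N * (3 * κ + 1) * volume.real (Ioc A₂ B₂ \ Prod.mk x ⁻¹' F) := by
  have ha₂ : a₂ ≤ b₂ := (hFR hp).2.1
  have hlen₁ : ∀ {s t : ℝ}, s ∈ Icc a₁ b₁ → t ∈ Icc a₁ b₁ → |s - t| ≤ B₁ - A₁ := fun hs ht =>
    abs_sub_le_of_le_of_le (hA₁.trans hs.1) (hs.2.trans hB₁) (hA₁.trans ht.1) (ht.2.trans hB₁)
  have hlen₂ : ∀ {s t : ℝ}, s ∈ Icc A₂ B₂ → t ∈ Icc a₂ b₂ → |s - t| ≤ B₂ - A₂ := fun hs ht =>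
    abs_sub_le_of_le_of_le hs.1 hs.2 (hA₂.trans ht.1) (ht.2.trans hB₂)
  rcases (Prod.mk x ⁻¹' F).eq_empty_or_nonempty with hempty | hne
  · have hxp := hlen₁ hx (hFR hp).1
    have hxq := hlen₁ hx (hFR hq).1
    have hpq := hlen₁ (hFR hp).1 (hFR hq).1
    have hab := hlen₂ ⟨hA₂, ha₂.trans hB₂⟩ (right_mem_Icc.2 ha₂)
    rw [hempty, setIntegral_empty, sub_zero, sdiff_empty,
      Real.volume_real_Ioc_of_le (hA₂.trans (ha₂.trans hB₂)), mul_assoc]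
    refine (abs_sub_le_of_mem_axisLipschitz (hFw hp) (hFw hq) (hxp.trans hδ₁) (hxq.trans hδ₁)
      (hpq.trans hδ₁) (hab.trans hδ₂)).trans (mul_le_mul_of_nonneg_left ?_ N.2)
    linarith
  · calc |w (x, b₂) - w (x, a₂) - ∫ y in Prod.mk x ⁻¹' F, D (x, y)|
        ≤ N * volume.real (Ioc a₂ b₂ \ Prod.mk x ⁻¹' F) :=
          abs_sub_sub_setIntegral_le (g := fun y => w (x, y)) ha₂ (measurable_prodMk_left hF)
            (fun y hy => (hFR hy).2) hne (fun y hy => hd _ hy) fun y hy y' hy' =>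
              abs_sub_snd_le_of_mem_axisLipschitz (hFw hy) ((hlen₂
                (Icc_subset_Icc hA₂ hB₂ hy') (hFR hy).2).trans hδ₂)
      _ ≤ N * (3 * κ + 1) * volume.real (Ioc A₂ B₂ \ Prod.mk x ⁻¹' F) := by
          have hfin : volume (Ioc A₂ B₂ \ Prod.mk x ⁻¹' F) < ⊤ :=
            (measure_mono sdiff_subset).trans_lt measure_Ioc_lt_top
          exact mul_le_mul (le_mul_of_one_le_right N.2 (by linarith)) (measureReal_mono
            (sdiff_subset_sdiff_left (Ioc_subset_Ioc hA₂ hB₂)) hfin.ne) measureReal_nonneg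
            (by positivity)

theorem abs_integral_sub_setIntegral_le (hw : Continuous w) (hF : IsCompact F)
    (hFw : F ⊆ axisLipschitz w N δ) (hFR : F ⊆ Icc a₁ b₁ ×ˢ Icc a₂ b₂) (hA₁ : A₁ ≤ a₁)
    (hB₁ : b₁ ≤ B₁) (hA₂ : A₂ ≤ a₂) (hB₂ : b₂ ≤ B₂) (hδ : 0 < δ) (hδ₁ : B₁ - A₁ ≤ δ)
    (hδ₂ : B₂ - A₂ ≤ δ) (hκ₀ : 0 ≤ κ) (hκ : B₁ - A₁ ≤ κ * (B₂ - A₂)) (hp : (p, b₂) ∈ F)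
    (hq : (q, a₂) ∈ F) (hd : ∀ z ∈ F, HasDerivAt (fun y => w (z.1, y)) (D z) z.2) :
    |(∫ x in a₁..b₁, (w (x, b₂) - w (x, a₂))) - ∫ z in F, D z| ≤
      N * (3 * κ + 1) * volume.real ((Ioc A₁ B₁ ×ˢ Ioc A₂ B₂) \ F) := by
  have ha₁ : a₁ ≤ b₁ := (hFR hp).1.1.trans (hFR hp).1.2
  set T := (Ioc A₁ B₁ ×ˢ Ioc A₂ B₂) \ F
  have hT : MeasurableSet T := (measurableSet_Ioc.prod measurableSet_Ioc).diff hF.measurableSet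
  have hT' : IntegrableOn (fun _ => (1 : ℝ)) T := integrableOn_const
    (((Metric.isBounded_Ioc _ _).prod (Metric.isBounded_Ioc _ _)).subset
      sdiff_subset).measure_lt_top.ne
  have hTi : Integrable fun x => N * (3 * κ + 1) * ∫ _ in Prod.mk x ⁻¹' T, (1 : ℝ) :=
    (integrable_setIntegral_slice hT hT').const_mul _
  have hDi := integrableOn_of_hasDerivAt_snd hw hF hδ hFw hd
  have hslice : ∀ x ∈ Ioc a₁ b₁,
      ‖w (x, b₂) - w (x, a₂) - ∫ y in Prod.mk x ⁻¹' F, D (x, y)‖ ≤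
        N * (3 * κ + 1) * ∫ _ in Prod.mk x ⁻¹' T, (1 : ℝ) := fun x hx => by
    have hTx : Prod.mk x ⁻¹' T = Ioc A₂ B₂ \ Prod.mk x ⁻¹' F := by
      ext y
      simp [T, hA₁.trans_lt hx.1, hx.2.trans hB₁]
    rw [setIntegral_const, smul_eq_mul, mul_one, hTx, Real.norm_eq_abs]
    exact abs_sub_sub_setIntegral_slice_le hF.measurableSet hFw hFR hA₁ hB₁ hA₂ hB₂ hδ₁ hδ₂ hκ₀ hκ
      hp hq hd (Ioc_subset_Icc_self hx)
  calc |(∫ x in a₁..b₁, (w (x, b₂) - w (x, a₂))) - ∫ z in F, D z|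
      = ‖∫ x in a₁..b₁, (w (x, b₂) - w (x, a₂) - ∫ y in Prod.mk x ⁻¹' F, D (x, y))‖ := by
        rw [setIntegral_eq_integral_slices ha₁ hF.measurableSet (fun z hz => (hFR hz).1) hDi,
          Real.norm_eq_abs, ← intervalIntegral.integral_sub
            (Continuous.intervalIntegrable (by fun_prop) _ _)
            (integrable_setIntegral_slice hF.measurableSet hDi).intervalIntegrable]
    _ ≤ ∫ x in a₁..b₁, N * (3 * κ + 1) * ∫ _ in Prod.mk x ⁻¹' T, (1 : ℝ) :=
        intervalIntegral.norm_integral_le_of_norm_le ha₁ (Eventually.of_forall hslice)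
          hTi.intervalIntegrable
    _ ≤ ∫ x in A₁..B₁, N * (3 * κ + 1) * ∫ _ in Prod.mk x ⁻¹' T, (1 : ℝ) :=
        intervalIntegral.integral_mono_interval hA₁ ha₁ hB₁
          (Eventually.of_forall fun x => by positivity) hTi.intervalIntegrable
    _ = N * (3 * κ + 1) * volume.real T := by
        rw [intervalIntegral.integral_const_mul, ← setIntegral_eq_integral_slices
          (hA₁.trans (ha₁.trans hB₁)) hT (fun z hz => Ioc_subset_Icc_self hz.1.1) hT',
          setIntegral_const, smul_eq_mul, mul_one]

end Rectangles

section RectIntegral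

variable {E : Type*} [NormedAddCommGroup E] [NormedSpace ℝ E] {P Q : ℝ × ℝ → E}
  {x₁ x₂ y₁ y₂ : ℝ}

/-- The integral of the form `P dx + Q dy` along the positively oriented boundary of
`[x₁, x₂] × [y₁, y₂]`. -/
noncomputable def rectIntegral (P Q : ℝ × ℝ → E) (x₁ x₂ y₁ y₂ : ℝ) : E :=
  (∫ x in x₁..x₂, P (x, y₁)) + (∫ y in y₁..y₂, Q (x₂, y)) - (∫ x in x₁..x₂, P (x, y₂)) -
    ∫ y in y₁..y₂, Q (x₁, y)

/-- The open set of points near which the form `P dx + Q dy` is closed, in the sense that its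
integrals along the boundaries of small rectangles vanish. -/
def closedLocus (P Q : ℝ × ℝ → E) : Set (ℝ × ℝ) :=
  ⋃₀ {U | IsOpen U ∧ ∀ x₁ x₂ y₁ y₂ : ℝ, x₁ ≤ x₂ → y₁ ≤ y₂ → Icc x₁ x₂ ×ˢ Icc y₁ y₂ ⊆ U →
    rectIntegral P Q x₁ x₂ y₁ y₂ = 0}

theorem isOpen_closedLocus (P Q : ℝ × ℝ → E) : IsOpen (closedLocus P Q) :=
  isOpen_sUnion fun _ hU => hU.1

theorem rectIntegral_self_fst (P Q : ℝ × ℝ → E) (x y₁ y₂ : ℝ) : rectIntegral P Q x x y₁ y₂ = 0 := by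
  simp [rectIntegral]

theorem rectIntegral_self_snd (P Q : ℝ × ℝ → E) (x₁ x₂ y : ℝ) : rectIntegral P Q x₁ x₂ y y = 0 := by
  simp [rectIntegral]

theorem rectIntegral_congr {P' Q' : ℝ × ℝ → E} (hx : x₁ ≤ x₂) (hy : y₁ ≤ y₂)
    (hP : EqOn P P' (Icc x₁ x₂ ×ˢ Icc y₁ y₂)) (hQ : EqOn Q Q' (Icc x₁ x₂ ×ˢ Icc y₁ y₂)) :
    rectIntegral P Q x₁ x₂ y₁ y₂ = rectIntegral P' Q' x₁ x₂ y₁ y₂ := by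
  have hPy : ∀ y ∈ Icc y₁ y₂, ∫ x in x₁..x₂, P (x, y) = ∫ x in x₁..x₂, P' (x, y) :=
    fun y hy => intervalIntegral.integral_congr fun x hx' => hP ⟨uIcc_of_le hx ▸ hx', hy⟩
  have hQx : ∀ x ∈ Icc x₁ x₂, ∫ y in y₁..y₂, Q (x, y) = ∫ y in y₁..y₂, Q' (x, y) :=
    fun x hx => intervalIntegral.integral_congr fun y hy' => hQ ⟨hx, uIcc_of_le hy ▸ hy'⟩
  rw [rectIntegral, rectIntegral, hPy _ (left_mem_Icc.2 hy), hPy _ (right_mem_Icc.2 hy),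
    hQx _ (left_mem_Icc.2 hx), hQx _ (right_mem_Icc.2 hx)]

theorem dist_le_max_of_mem_Icc_prod {z w : ℝ × ℝ} (hz : z ∈ Icc x₁ x₂ ×ˢ Icc y₁ y₂)
    (hw : w ∈ Icc x₁ x₂ ×ˢ Icc y₁ y₂) : dist z w ≤ max (x₂ - x₁) (y₂ - y₁) :=
  max_le_max (Real.dist_le_of_mem_Icc hz.1 hw.1) (Real.dist_le_of_mem_Icc hz.2 hw.2)

theorem exists_div_two_pow_lt (a b : ℝ) {δ : ℝ} (hδ : 0 < δ) :
    ∃ n : ℕ, max (a / 2 ^ n) (b / 2 ^ n) < δ := by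
  obtain ⟨n, hn⟩ := pow_unbounded_of_one_lt (max a b / δ) one_lt_two
  refine ⟨n, ?_⟩
  rwa [max_div_div_right (by positivity), div_lt_comm₀ (by positivity) hδ]

theorem measureReal_Ioc_prod_eq_add (ν : Measure (ℝ × ℝ)) [IsFiniteMeasure ν] {m n : ℝ}
    (hm : m ∈ Icc x₁ x₂) (hn : n ∈ Icc y₁ y₂) :
    ν.real (Ioc x₁ x₂ ×ˢ Ioc y₁ y₂) =
      ν.real (Ioc x₁ m ×ˢ Ioc y₁ n) + ν.real (Ioc x₁ m ×ˢ Ioc n y₂) +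
        (ν.real (Ioc m x₂ ×ˢ Ioc y₁ n) + ν.real (Ioc m x₂ ×ˢ Ioc n y₂)) := by
  have hsnd : ∀ a b, ν.real (Ioc a b ×ˢ Ioc y₁ y₂) =
      ν.real (Ioc a b ×ˢ Ioc y₁ n) + ν.real (Ioc a b ×ˢ Ioc n y₂) := fun a b => by
    rw [← Ioc_union_Ioc_eq_Ioc hn.1 hn.2, prod_union, measureReal_union
      (Disjoint.set_prod_right (Ioc_disjoint_Ioc_of_le le_rfl) _ _)
      (measurableSet_Ioc.prod measurableSet_Ioc)]
  rw [← hsnd, ← hsnd, ← Ioc_union_Ioc_eq_Ioc hm.1 hm.2, union_prod, measureReal_union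
    (Disjoint.set_prod_left (Ioc_disjoint_Ioc_of_le le_rfl) _ _)
    (measurableSet_Ioc.prod measurableSet_Ioc)]

section Continuous

variable (hP : Continuous P) (hQ : Continuous Q)

include hP in
theorem rectIntegral_add_adjacent_fst (x₁ x₂ x₃ y₁ y₂ : ℝ) :
    rectIntegral P Q x₁ x₂ y₁ y₂ + rectIntegral P Q x₂ x₃ y₁ y₂ = rectIntegral P Q x₁ x₃ y₁ y₂ := by
  have hi : ∀ y a b, IntervalIntegrable (fun x => P (x, y)) volume a b := fun y a b =>
    Continuous.intervalIntegrable (by fun_prop) _ _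
  simp only [rectIntegral, ← intervalIntegral.integral_add_adjacent_intervals (hi y₁ x₁ x₂)
    (hi y₁ x₂ x₃), ← intervalIntegral.integral_add_adjacent_intervals (hi y₂ x₁ x₂) (hi y₂ x₂ x₃)]
  abel

include hQ in
theorem rectIntegral_add_adjacent_snd (x₁ x₂ y₁ y₂ y₃ : ℝ) :
    rectIntegral P Q x₁ x₂ y₁ y₂ + rectIntegral P Q x₁ x₂ y₂ y₃ = rectIntegral P Q x₁ x₂ y₁ y₃ := by
  have hi : ∀ x a b, IntervalIntegrable (fun y => Q (x, y)) volume a b := fun y a b =>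
    Continuous.intervalIntegrable (by fun_prop) _ _
  simp only [rectIntegral, ← intervalIntegral.integral_add_adjacent_intervals (hi x₁ y₁ y₂)
    (hi x₁ y₂ y₃), ← intervalIntegral.integral_add_adjacent_intervals (hi x₂ y₁ y₂) (hi x₂ y₂ y₃)]
  abel

include hP hQ

theorem norm_rectIntegral_le_of_subdivision (ν : Measure (ℝ × ℝ)) [IsFiniteMeasure ν] (C : ℝ)
    (n : ℕ) : ∀ {x₁ x₂ y₁ y₂ : ℝ}, x₁ ≤ x₂ → y₁ ≤ y₂ →
      (∀ a₁ b₁ a₂ b₂, b₁ - a₁ = (x₂ - x₁) / 2 ^ n → b₂ - a₂ = (y₂ - y₁) / 2 ^ n →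
        Icc a₁ b₁ ×ˢ Icc a₂ b₂ ⊆ Icc x₁ x₂ ×ˢ Icc y₁ y₂ →
        ‖rectIntegral P Q a₁ b₁ a₂ b₂‖ ≤ C * ν.real (Ioc a₁ b₁ ×ˢ Ioc a₂ b₂)) →
      ‖rectIntegral P Q x₁ x₂ y₁ y₂‖ ≤ C * ν.real (Ioc x₁ x₂ ×ˢ Ioc y₁ y₂) := by
  induction n with
  | zero => exact fun _ _ h => h _ _ _ _ (by simp) (by simp) Subset.rfl
  | succ n ih =>
    intro x₁ x₂ y₁ y₂ hx hy h
    have hquarter : ∀ a₁ b₁ a₂ b₂, b₁ - a₁ = (x₂ - x₁) / 2 → b₂ - a₂ = (y₂ - y₁) / 2 →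
        x₁ ≤ a₁ → b₁ ≤ x₂ → y₁ ≤ a₂ → b₂ ≤ y₂ →
        ‖rectIntegral P Q a₁ b₁ a₂ b₂‖ ≤ C * ν.real (Ioc a₁ b₁ ×ˢ Ioc a₂ b₂) := by
      intro a₁ b₁ a₂ b₂ hab₁ hab₂ h₁ h₂ h₃ h₄
      refine ih (by linarith) (by linarith) fun c₁ d₁ c₂ d₂ hcd₁ hcd₂ hsub => h _ _ _ _ ?_ ?_
        (hsub.trans (Set.prod_mono (Icc_subset_Icc h₁ h₂) (Icc_subset_Icc h₃ h₄)))
      · rw [hcd₁, hab₁, div_div, pow_succ']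
      · rw [hcd₂, hab₂, div_div, pow_succ']
    have hm : (x₁ + x₂) / 2 ∈ Icc x₁ x₂ := ⟨by linarith, by linarith⟩
    have hn : (y₁ + y₂) / 2 ∈ Icc y₁ y₂ := ⟨by linarith, by linarith⟩
    rw [← rectIntegral_add_adjacent_fst hP x₁ ((x₁ + x₂) / 2) x₂,
      ← rectIntegral_add_adjacent_snd hQ _ _ y₁ ((y₁ + y₂) / 2) y₂,
      ← rectIntegral_add_adjacent_snd hQ _ _ y₁ ((y₁ + y₂) / 2) y₂,
      measureReal_Ioc_prod_eq_add ν hm hn, mul_add, mul_add, mul_add]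
    refine norm_add_le_of_le (norm_add_le_of_le ?_ ?_) (norm_add_le_of_le ?_ ?_) <;>
      apply hquarter <;> linarith

theorem rectIntegral_eq_zero_of_subset_closedLocus (hx : x₁ ≤ x₂) (hy : y₁ ≤ y₂)
    (h : Icc x₁ x₂ ×ˢ Icc y₁ y₂ ⊆ closedLocus P Q) : rectIntegral P Q x₁ x₂ y₁ y₂ = 0 := by
  obtain ⟨δ, hδ, hball⟩ := lebesgue_number_lemma_of_metric_sUnion
    (isCompact_Icc.prod isCompact_Icc) (fun _ hU => hU.1) h
  obtain ⟨n, hn⟩ := exists_div_two_pow_lt (x₂ - x₁) (y₂ - y₁) hδ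
  have hle := norm_rectIntegral_le_of_subdivision hP hQ 0 0 n hx hy
    fun a₁ b₁ a₂ b₂ hab₁ hab₂ hsub => ?_
  · simpa using hle
  have ha₁ : a₁ ≤ b₁ := sub_nonneg.1 (hab₁ ▸ div_nonneg (sub_nonneg.2 hx) (by positivity))
  have ha₂ : a₂ ≤ b₂ := sub_nonneg.1 (hab₂ ▸ div_nonneg (sub_nonneg.2 hy) (by positivity))
  have hcorner : (a₁, a₂) ∈ Icc a₁ b₁ ×ˢ Icc a₂ b₂ := ⟨left_mem_Icc.2 ha₁, left_mem_Icc.2 ha₂⟩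
  obtain ⟨U, hU, hsubU⟩ := hball _ (hsub hcorner)
  rw [hU.2 a₁ b₁ a₂ b₂ ha₁ ha₂ fun z hz => hsubU ?_]
  · simp
  · rw [← hab₁, ← hab₂] at hn
    exact (dist_le_max_of_mem_Icc_prod hz hcorner).trans_lt hn

end Continuous

theorem continuous_integral_of_continuous {X : Type*} [TopologicalSpace X]
    {f : X → ℝ → E} (hf : Continuous (Function.uncurry f))
    {u v : X → ℝ} (hu : Continuous u) (hv : Continuous v) :
    Continuous fun s => ∫ x in u s..v s, f s x := by
  have hi : ∀ s a b, IntervalIntegrable (f s) volume a b := fun s a b =>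
    Continuous.intervalIntegrable (by fun_prop) _ _
  simp only [← fun s => intervalIntegral.integral_interval_sub_left (hi s 0 (v s)) (hi s 0 (u s))]
  exact (intervalIntegral.continuous_parametric_intervalIntegral_of_continuous hf hv).sub
    (intervalIntegral.continuous_parametric_intervalIntegral_of_continuous hf hu)

section Continuous

variable (hP : Continuous P) (hQ : Continuous Q)

include hP hQ

theorem continuous_rectIntegral {u v s t : ℝ → ℝ} (hu : Continuous u) (hv : Continuous v)
    (hs : Continuous s) (ht : Continuous t) :
    Continuous fun r => rectIntegral P Q (u r) (v r) (s r) (t r) :=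
  (((continuous_integral_of_continuous (by fun_prop) hu hv).add
    (continuous_integral_of_continuous (by fun_prop) hs ht)).sub
    (continuous_integral_of_continuous (by fun_prop) hu hv)).sub
    (continuous_integral_of_continuous (by fun_prop) hs ht)

theorem rectIntegral_eq_zero_of_Ioo_subset_closedLocus (hx : x₁ ≤ x₂) (hy : y₁ ≤ y₂)
    (h : Ioo x₁ x₂ ×ˢ Ioo y₁ y₂ ⊆ closedLocus P Q) : rectIntegral P Q x₁ x₂ y₁ y₂ = 0 := by
  rcases hx.eq_or_lt with rfl | hx
  · exact rectIntegral_self_fst _ _ _ _ _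
  rcases hy.eq_or_lt with rfl | hy
  · exact rectIntegral_self_snd _ _ _ _ _
  have hlim : Tendsto (fun r => rectIntegral P Q (x₁ + r) (x₂ - r) (y₁ + r) (y₂ - r)) (𝓝[>] 0)
      (𝓝 (rectIntegral P Q x₁ x₂ y₁ y₂)) := by
    refine tendsto_nhdsWithin_of_tendsto_nhds ((continuous_rectIntegral hP hQ
      (u := fun r => x₁ + r) (v := fun r => x₂ - r) (s := fun r => y₁ + r) (t := fun r => y₂ - r)
      ?_ ?_ ?_ ?_).tendsto' 0 _ (by simp)) <;> fun_prop
  refine tendsto_nhds_unique_of_eventuallyEq hlim tendsto_const_nhds ?_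
  filter_upwards [Ioo_mem_nhdsGT (half_pos (sub_pos.2 hx)),
    Ioo_mem_nhdsGT (half_pos (sub_pos.2 hy))] with r hrx hry
  exact rectIntegral_eq_zero_of_subset_closedLocus hP hQ (by linarith [hrx.2]) (by linarith [hry.2])
    ((Set.prod_mono (Icc_subset_Ioo (by linarith [hrx.1]) (by linarith [hrx.1]))
      (Icc_subset_Ioo (by linarith [hry.1]) (by linarith [hry.1]))).trans h)

theorem rectIntegral_eq_of_sdiff_subset_closedLocus {a₁ b₁ a₂ b₂ : ℝ} (hx₁ : x₁ ≤ a₁)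
    (ha₁ : a₁ ≤ b₁) (hx₂ : b₁ ≤ x₂) (hy₁ : y₁ ≤ a₂) (ha₂ : a₂ ≤ b₂) (hy₂ : b₂ ≤ y₂)
    (h : (Icc x₁ x₂ ×ˢ Icc y₁ y₂) \ (Icc a₁ b₁ ×ˢ Icc a₂ b₂) ⊆ closedLocus P Q) :
    rectIntegral P Q x₁ x₂ y₁ y₂ = rectIntegral P Q a₁ b₁ a₂ b₂ := by
  have hzero : ∀ c₁ d₁ c₂ d₂, x₁ ≤ c₁ → c₁ ≤ d₁ → d₁ ≤ x₂ → y₁ ≤ c₂ → c₂ ≤ d₂ → d₂ ≤ y₂ →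
      d₁ ≤ a₁ ∨ b₁ ≤ c₁ ∨ d₂ ≤ a₂ ∨ b₂ ≤ c₂ → rectIntegral P Q c₁ d₁ c₂ d₂ = 0 := by
    intro c₁ d₁ c₂ d₂ i₁ i₂ i₃ i₄ i₅ i₆ hside
    refine rectIntegral_eq_zero_of_Ioo_subset_closedLocus hP hQ i₂ i₅ fun z hz => h ?_
    simp only [mem_prod, mem_Ioo, Set.mem_sdiff, mem_Icc] at hz ⊢
    grind
  rw [← rectIntegral_add_adjacent_fst hP x₁ a₁ x₂, ← rectIntegral_add_adjacent_fst hP a₁ b₁ x₂,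
    ← rectIntegral_add_adjacent_snd hQ a₁ b₁ y₁ a₂ y₂,
    ← rectIntegral_add_adjacent_snd hQ a₁ b₁ a₂ b₂ y₂,
    hzero x₁ a₁ y₁ y₂, hzero b₁ x₂ y₁ y₂, hzero a₁ b₁ y₁ a₂, hzero a₁ b₁ b₂ y₂] <;>
    grind

end Continuous

end RectIntegral

section LoomanMenchoff

theorem exists_boundingBox {F : Set (ℝ × ℝ)} (hF : IsCompact F) (hne : F.Nonempty) :
    ∃ a₁ b₁ a₂ b₂, F ⊆ Icc a₁ b₁ ×ˢ Icc a₂ b₂ ∧ (∃ y, (a₁, y) ∈ F) ∧ (∃ y, (b₁, y) ∈ F) ∧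
      (∃ x, (x, a₂) ∈ F) ∧ ∃ x, (x, b₂) ∈ F := by
  obtain ⟨z₁, hz₁, hmin₁⟩ := hF.exists_isMinOn hne continuous_fst.continuousOn
  obtain ⟨z₂, hz₂, hmax₁⟩ := hF.exists_isMaxOn hne continuous_fst.continuousOn
  obtain ⟨z₃, hz₃, hmin₂⟩ := hF.exists_isMinOn hne continuous_snd.continuousOn
  obtain ⟨z₄, hz₄, hmax₂⟩ := hF.exists_isMaxOn hne continuous_snd.continuousOn
  exact ⟨z₁.1, z₂.1, z₃.2, z₄.2, fun z hz => ⟨⟨hmin₁ hz, hmax₁ hz⟩, hmin₂ hz, hmax₂ hz⟩,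
    ⟨_, hz₁⟩, ⟨_, hz₂⟩, ⟨_, hz₃⟩, ⟨_, hz₄⟩⟩

variable {P Q D : ℝ × ℝ → ℝ} {F : Set (ℝ × ℝ)} {a₁ b₁ a₂ b₂ A₁ B₁ A₂ B₂ x₁ x₂ y₁ y₂ p q δ κ : ℝ}
  {N : ℝ≥0}

theorem measurePreserving_prodSwap :
    MeasurePreserving (Prod.swap : ℝ × ℝ → ℝ × ℝ) volume volume := by
  rw [Measure.volume_eq_prod]
  exact Measure.measurePreserving_swap

theorem abs_integral_sub_setIntegral_swap_le (hQ : Continuous Q) (hF : IsCompact F)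
    (hFQ : F ⊆ axisLipschitz Q N δ) (hFR : F ⊆ Icc a₁ b₁ ×ˢ Icc a₂ b₂) (hA₁ : A₁ ≤ a₁)
    (hB₁ : b₁ ≤ B₁) (hA₂ : A₂ ≤ a₂) (hB₂ : b₂ ≤ B₂) (hδ : 0 < δ) (hδ₁ : B₁ - A₁ ≤ δ)
    (hδ₂ : B₂ - A₂ ≤ δ) (hκ₀ : 0 ≤ κ) (hκ : B₂ - A₂ ≤ κ * (B₁ - A₁)) (hp : (b₁, p) ∈ F)
    (hq : (a₁, q) ∈ F) (hd : ∀ z ∈ F, HasDerivAt (fun x => Q (x, z.2)) (D z) z.1) :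
    |(∫ y in a₂..b₂, (Q (b₁, y) - Q (a₁, y))) - ∫ z in F, D z| ≤
      N * (3 * κ + 1) * volume.real ((Ioc A₁ B₁ ×ˢ Ioc A₂ B₂) \ F) := by
  have hemb : MeasurableEmbedding (Prod.swap : ℝ × ℝ → ℝ × ℝ) :=
    MeasurableEquiv.prodComm.measurableEmbedding
  have hF' : IsCompact (Prod.swap ⁻¹' F) :=
    image_swap_eq_preimage_swap (α := ℝ) (β := ℝ) ▸ hF.image continuous_swap
  have h := abs_integral_sub_setIntegral_le (w := Q ∘ Prod.swap) (D := D ∘ Prod.swap)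
    (hQ.comp continuous_swap) hF' (axisLipschitz_comp_swap Q N δ ▸ preimage_mono hFQ)
    (fun z hz => ⟨(hFR hz).2, (hFR hz).1⟩) hA₂ hB₂ hA₁ hB₁ hδ hδ₂ hδ₁ hκ₀ hκ hp hq
    fun z hz => hd _ hz
  rwa [← preimage_swap_prod, ← preimage_sdiff, measureReal_def,
    measurePreserving_prodSwap.measure_preimage_emb hemb,
    show ∫ z in Prod.swap ⁻¹' F, (D ∘ Prod.swap) z = ∫ z in F, D z from
      measurePreserving_prodSwap.setIntegral_preimage_emb hemb D F] at h

/-- The points of the rectangle at which `P dx + Q dy` is not known to be closed. -/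
def singularPart (P Q : ℝ × ℝ → ℝ) (x₁ x₂ y₁ y₂ : ℝ) : Set (ℝ × ℝ) :=
  (Icc x₁ x₂ ×ˢ Icc y₁ y₂) \ closedLocus P Q

theorem isCompact_singularPart (P Q : ℝ × ℝ → ℝ) (x₁ x₂ y₁ y₂ : ℝ) :
    IsCompact (singularPart P Q x₁ x₂ y₁ y₂) :=
  (isCompact_Icc.prod isCompact_Icc).diff (isOpen_closedLocus P Q)

theorem tendsto_measureReal_cthickening_sdiff {X : Type*} [MetricSpace X] [ProperSpace X]
    [MeasurableSpace X] [BorelSpace X] (μ : Measure X) [IsFiniteMeasureOnCompacts μ]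
    {K : Set X} (hK : IsCompact K) :
    Tendsto (fun η => μ.real (cthickening η K \ K)) (𝓝 0) (𝓝 0) := by
  have hlim := ((ENNReal.tendsto_toReal hK.measure_lt_top.ne).comp
    (tendsto_measure_cthickening_of_isCompact (μ := μ) hK)).sub_const (μ.real K)
  rw [← measureReal_def, sub_self] at hlim
  exact hlim.congr fun η => (measureReal_sdiff (self_subset_cthickening K) hK.measurableSet
    hK.cthickening.measure_lt_top.ne).symm

section

variable (hP : Continuous P) (hQ : Continuous Q) (hδ : 0 < δ) (hδ₁ : x₂ - x₁ ≤ δ)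
  (hδ₂ : y₂ - y₁ ≤ δ) (hFP : singularPart P Q x₁ x₂ y₁ y₂ ⊆ axisLipschitz P N δ)
  (hFQ : singularPart P Q x₁ x₂ y₁ y₂ ⊆ axisLipschitz Q N δ)
  (hPy : ∀ z ∈ singularPart P Q x₁ x₂ y₁ y₂, HasDerivAt (fun y => P (z.1, y)) (D z) z.2)
  (hQx : ∀ z ∈ singularPart P Q x₁ x₂ y₁ y₂, HasDerivAt (fun x => Q (x, z.2)) (D z) z.1)

include hP hQ hδ hδ₁ hδ₂ hFP hFQ hPy hQx

theorem abs_rectIntegral_le (hne : (singularPart P Q x₁ x₂ y₁ y₂).Nonempty) (hκ₀ : 0 ≤ κ)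
    (hκ₁ : x₂ - x₁ ≤ κ * (y₂ - y₁)) (hκ₂ : y₂ - y₁ ≤ κ * (x₂ - x₁)) :
    |rectIntegral P Q x₁ x₂ y₁ y₂| ≤ 2 * (N * (3 * κ + 1)) *
      volume.real ((Ioc x₁ x₂ ×ˢ Ioc y₁ y₂) \ singularPart P Q x₁ x₂ y₁ y₂) := by
  have hF := isCompact_singularPart P Q x₁ x₂ y₁ y₂
  have hFR : singularPart P Q x₁ x₂ y₁ y₂ ⊆ Icc x₁ x₂ ×ˢ Icc y₁ y₂ := sdiff_subset
  have hcl : (Icc x₁ x₂ ×ˢ Icc y₁ y₂) \ singularPart P Q x₁ x₂ y₁ y₂ ⊆ closedLocus P Q :=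
    sdiff_sdiff_right_self.trans_subset inter_subset_right
  obtain ⟨a₁, b₁, a₂, b₂, hbox, ⟨s, hs⟩, ⟨t, ht⟩, ⟨u, hu⟩, v, hv⟩ := exists_boundingBox hF hne
  have hPi : ∀ y a b, IntervalIntegrable (fun x => P (x, y)) volume a b := fun y a b =>
    Continuous.intervalIntegrable (by fun_prop) _ _
  have hQi : ∀ x a b, IntervalIntegrable (fun y => Q (x, y)) volume a b := fun x a b =>
    Continuous.intervalIntegrable (by fun_prop) _ _
  have hP' := abs_integral_sub_setIntegral_le hP hF hFP hbox (hFR hs).1.1 (hFR ht).1.2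
    (hFR hu).2.1 (hFR hv).2.2 hδ hδ₁ hδ₂ hκ₀ hκ₁ hv hu hPy
  have hQ' := abs_integral_sub_setIntegral_swap_le hQ hF hFQ hbox (hFR hs).1.1 (hFR ht).1.2
    (hFR hu).2.1 (hFR hv).2.2 hδ hδ₁ hδ₂ hκ₀ hκ₂ ht hs hQx
  rw [intervalIntegral.integral_sub (hPi _ _ _) (hPi _ _ _)] at hP'
  rw [intervalIntegral.integral_sub (hQi _ _ _) (hQi _ _ _)] at hQ'
  rw [rectIntegral_eq_of_sdiff_subset_closedLocus hP hQ (hFR hs).1.1 (hbox hs).1.2 (hFR ht).1.2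
    (hFR hu).2.1 (hbox hu).2.2 (hFR hv).2.2
    ((sdiff_subset_sdiff_right hbox).trans hcl), rectIntegral]
  rw [abs_le] at *
  constructor <;> linarith

theorem abs_rectIntegral_le_measureReal_cthickening (hx : x₁ ≤ x₂) (hy : y₁ ≤ y₂) (hκ₀ : 0 ≤ κ)
    (hκ₁ : x₂ - x₁ ≤ κ * (y₂ - y₁)) (hκ₂ : y₂ - y₁ ≤ κ * (x₂ - x₁)) {η : ℝ} (hη : 0 < η) :
    |rectIntegral P Q x₁ x₂ y₁ y₂| ≤ 2 * (N * (3 * κ + 1)) * volume.real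
      (cthickening η (singularPart P Q x₁ x₂ y₁ y₂) \ singularPart P Q x₁ x₂ y₁ y₂) := by
  set K := singularPart P Q x₁ x₂ y₁ y₂
  set T := cthickening η K \ K
  have hfin : volume T < ⊤ := (measure_mono sdiff_subset).trans_lt
    (isCompact_singularPart P Q x₁ x₂ y₁ y₂).cthickening.measure_lt_top
  have : Fact (volume T < ⊤) := ⟨hfin⟩
  obtain ⟨n, hn⟩ := exists_div_two_pow_lt (x₂ - x₁) (y₂ - y₁) hη
  have hsmall : ∀ {c : ℝ}, 0 ≤ c → c / 2 ^ n ≤ c := fun hc =>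
    div_le_self hc (one_le_pow₀ one_le_two)
  have hscale : ∀ {c d : ℝ}, c ≤ κ * d → c / 2 ^ n ≤ κ * (d / 2 ^ n) := fun h => by
    rw [← mul_div_assoc]
    gcongr
  refine (norm_rectIntegral_le_of_subdivision hP hQ (volume.restrict T) _ n hx hy
    fun a₁ b₁ a₂ b₂ hab₁ hab₂ hsub => ?_).trans (mul_le_mul_of_nonneg_left
      ((measureReal_mono (subset_univ _)).trans_eq (measureReal_restrict_apply_univ T))
      (by positivity))
  have hKsub : singularPart P Q a₁ b₁ a₂ b₂ ⊆ K := sdiff_subset_sdiff_left hsub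
  have ha₁ : a₁ ≤ b₁ := sub_nonneg.1 (hab₁ ▸ div_nonneg (sub_nonneg.2 hx) (by positivity))
  have ha₂ : a₂ ≤ b₂ := sub_nonneg.1 (hab₂ ▸ div_nonneg (sub_nonneg.2 hy) (by positivity))
  rcases (singularPart P Q a₁ b₁ a₂ b₂).eq_empty_or_nonempty with hempty | hne
  · rw [rectIntegral_eq_zero_of_subset_closedLocus hP hQ ha₁ ha₂ (sdiff_eq_empty.1 hempty),
      norm_zero]
    positivity
  refine (abs_rectIntegral_le hP hQ hδ (hab₁ ▸ (hsmall (sub_nonneg.2 hx)).trans hδ₁)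
    (hab₂ ▸ (hsmall (sub_nonneg.2 hy)).trans hδ₂) (hKsub.trans hFP) (hKsub.trans hFQ)
    (fun z hz => hPy z (hKsub hz)) (fun z hz => hQx z (hKsub hz)) hne hκ₀
    (hab₁ ▸ hab₂ ▸ hscale hκ₁) (hab₁ ▸ hab₂ ▸ hscale hκ₂)).trans
    (mul_le_mul_of_nonneg_left ?_ (by positivity))
  obtain ⟨z, hz⟩ := hne
  rw [measureReal_restrict_apply (measurableSet_Ioc.prod measurableSet_Ioc)]
  refine measureReal_mono (fun w hw => ⟨hw.1, ?_, fun hwK => hw.2 ⟨?_, hwK.2⟩⟩)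
    ((measure_mono inter_subset_right).trans_lt hfin).ne
  all_goals
    have hwcell : w ∈ Icc a₁ b₁ ×ˢ Icc a₂ b₂ :=
      Set.prod_mono Ioc_subset_Icc_self Ioc_subset_Icc_self hw.1
  · rw [← hab₁, ← hab₂] at hn
    exact mem_cthickening_of_dist_le w z _ _ (hKsub hz)
      ((dist_le_max_of_mem_Icc_prod hwcell hz.1).trans hn.le)
  · exact hwcell

theorem rectIntegral_eq_zero_of_singularPart_subset (hx : x₁ ≤ x₂) (hy : y₁ ≤ y₂) :
    rectIntegral P Q x₁ x₂ y₁ y₂ = 0 := by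
  rcases hx.eq_or_lt with rfl | hx
  · exact rectIntegral_self_fst _ _ _ _ _
  rcases hy.eq_or_lt with rfl | hy
  · exact rectIntegral_self_snd _ _ _ _ _
  have hX : 0 < x₂ - x₁ := sub_pos.2 hx
  have hY : 0 < y₂ - y₁ := sub_pos.2 hy
  set κ := (x₂ - x₁) / (y₂ - y₁) + (y₂ - y₁) / (x₂ - x₁) with hκ
  have hκ₁ : x₂ - x₁ ≤ κ * (y₂ - y₁) := by
    rw [hκ, add_mul, div_mul_cancel₀ _ hY.ne']
    exact le_add_of_nonneg_right (by positivity)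
  have hκ₂ : y₂ - y₁ ≤ κ * (x₂ - x₁) := by
    rw [hκ, add_mul, div_mul_cancel₀ _ hX.ne']
    exact le_add_of_nonneg_left (by positivity)
  have hlim := ((tendsto_measureReal_cthickening_sdiff volume
    (isCompact_singularPart P Q x₁ x₂ y₁ y₂)).const_mul (2 * (N * (3 * κ + 1)))).mono_left
      (nhdsWithin_le_nhds (s := Ioi 0))
  rw [mul_zero] at hlim
  exact abs_nonpos_iff.1 (ge_of_tendsto hlim (eventually_mem_nhdsWithin.mono fun η hη =>
    abs_rectIntegral_le_measureReal_cthickening hP hQ hδ hδ₁ hδ₂ hFP hFQ hPy hQx hx.le hy.le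
      (by positivity) hκ₁ hκ₂ hη))

end

theorem axisLipschitz_mono {w : ℝ × ℝ → ℝ} {M : ℝ≥0} {ρ : ℝ} (hN : N ≤ M) (hρ : ρ ≤ δ) :
    axisLipschitz w N δ ⊆ axisLipschitz w M ρ := fun _ hz h hh =>
  have hle : N * |h| ≤ M * |h| := mul_le_mul_of_nonneg_right hN (abs_nonneg h)
  ⟨(hz h (hh.trans hρ)).1.trans hle, (hz h (hh.trans hρ)).2.trans hle⟩

theorem eventually_forall_abs_sub_le {f : ℝ → ℝ} {x : ℝ} (hf : DifferentiableAt ℝ f x) :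
    ∀ᶠ n : ℕ in atTop, ∀ h : ℝ, |h| ≤ 1 / ((n : ℝ) + 1) → |f (x + h) - f x| ≤ n * |h| := by
  obtain ⟨C, hC⟩ := hf.isBigO_sub.bound
  obtain ⟨r, hr, hball⟩ := Metric.eventually_nhds_iff.1 hC
  filter_upwards [tendsto_natCast_atTop_atTop.eventually_ge_atTop C,
    tendsto_one_div_add_atTop_nhds_zero_nat.eventually_lt_const hr] with n hnC hnr h hh
  have hle := hball (y := x + h) (by
    rw [Real.dist_eq, add_sub_cancel_left]
    exact hh.trans_lt hnr)
  rw [add_sub_cancel_left, Real.norm_eq_abs, Real.norm_eq_abs] at hle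
  exact hle.trans (mul_le_mul_of_nonneg_right hnC (abs_nonneg _))

theorem exists_isOpen_inter_subset_axisLipschitz {w : ℝ × ℝ → ℝ} (hw : Continuous w)
    {S : Set (ℝ × ℝ)} (hS : IsLocallyClosed S) (hne : S.Nonempty)
    (hx : ∀ z ∈ S, DifferentiableAt ℝ (fun x => w (x, z.2)) z.1)
    (hy : ∀ z ∈ S, DifferentiableAt ℝ (fun y => w (z.1, y)) z.2) :
    ∃ V, IsOpen V ∧ (S ∩ V).Nonempty ∧ ∃ N : ℝ≥0, ∃ δ > 0, S ∩ V ⊆ axisLipschitz w N δ := by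
  have : LocallyCompactSpace S := hS.locallyCompactSpace
  have : Nonempty S := hne.to_subtype
  have hcover : ⋃ n : ℕ, (Subtype.val ⁻¹' axisLipschitz w n (1 / ((n : ℝ) + 1)) : Set S) =
      univ := by
    refine eq_univ_of_forall fun z => mem_iUnion.2 ?_
    obtain ⟨n, hn₁, hn₂⟩ := ((eventually_forall_abs_sub_le (hx z z.2)).and
      (eventually_forall_abs_sub_le (hy z z.2))).exists
    exact ⟨n, fun h hh => ⟨by simpa using hn₁ h hh, by simpa using hn₂ h hh⟩⟩
  obtain ⟨n, z, hz⟩ := nonempty_interior_of_iUnion_of_closed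
    (fun n : ℕ => (isClosed_axisLipschitz hw n _).preimage continuous_subtype_val) hcover
  obtain ⟨_, hsub, ⟨V, hV, rfl⟩, hzV⟩ := mem_interior.1 hz
  exact ⟨V, hV, ⟨z, z.2, hzV⟩, n, _, Nat.one_div_pos_of_nat, fun y hy => hsub (a := ⟨y, hy.1⟩) hy.2⟩

theorem subset_closedLocus_of_hasDerivAt (hP : Continuous P) (hQ : Continuous Q) {U : Set (ℝ × ℝ)}
    (hU : IsOpen U) (hPx : ∀ z ∈ U, DifferentiableAt ℝ (fun x => P (x, z.2)) z.1)
    (hPy : ∀ z ∈ U, HasDerivAt (fun y => P (z.1, y)) (D z) z.2)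
    (hQx : ∀ z ∈ U, HasDerivAt (fun x => Q (x, z.2)) (D z) z.1)
    (hQy : ∀ z ∈ U, DifferentiableAt ℝ (fun y => Q (z.1, y)) z.2) :
    U ⊆ closedLocus P Q := by
  by_contra hnot
  have hS : IsLocallyClosed (U \ closedLocus P Q) :=
    hU.isLocallyClosed.inter (isOpen_closedLocus P Q).isClosed_compl.isLocallyClosed
  obtain ⟨V, hV, hVne, N, δ, hδ, hPV⟩ := exists_isOpen_inter_subset_axisLipschitz hP hS
    (sdiff_nonempty.2 hnot) (fun z hz => hPx z hz.1) fun z hz => (hPy z hz.1).differentiableAt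
  obtain ⟨W, hW, ⟨z₀, ⟨⟨hz₀U, hz₀⟩, hz₀V⟩, hz₀W⟩, M, ρ, hρ, hQW⟩ :=
    exists_isOpen_inter_subset_axisLipschitz hQ (hS.inter hV.isLocallyClosed) hVne
    (fun z hz => (hQx z hz.1.1).differentiableAt) fun z hz => hQy z hz.1.1
  set τ := min δ ρ
  have hτ₀ : 0 < τ := lt_min hδ hρ
  refine hz₀ ⟨U ∩ V ∩ W ∩ ball z₀ (τ / 2), ⟨((hU.inter hV).inter hW).inter isOpen_ball, ?_⟩,
    ⟨⟨hz₀U, hz₀V⟩, hz₀W⟩, mem_ball_self (half_pos hτ₀)⟩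
  intro x₁ x₂ y₁ y₂ hx hy hR
  have hsing : ∀ z ∈ singularPart P Q x₁ x₂ y₁ y₂, ((z ∈ U \ closedLocus P Q) ∧ z ∈ V) ∧ z ∈ W :=
    fun z hz => ⟨⟨⟨(hR hz.1).1.1.1, hz.2⟩, (hR hz.1).1.1.2⟩, (hR hz.1).1.2⟩
  have hdiam : dist (x₁, y₁) (x₂, y₂) ≤ τ := by
    have h₁ := (hR (a := (x₁, y₁)) ⟨left_mem_Icc.2 hx, left_mem_Icc.2 hy⟩).2
    have h₂ := (hR (a := (x₂, y₂)) ⟨right_mem_Icc.2 hx, right_mem_Icc.2 hy⟩).2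
    linarith [dist_triangle_right (x₁, y₁) (x₂, y₂) z₀, mem_ball.1 h₁, mem_ball.1 h₂]
  rw [Prod.dist_eq, max_le_iff, Real.dist_eq, Real.dist_eq, abs_sub_comm, abs_sub_comm y₁] at hdiam
  exact rectIntegral_eq_zero_of_singularPart_subset hP hQ hτ₀ (N := max N M)
    ((le_abs_self _).trans hdiam.1) ((le_abs_self _).trans hdiam.2)
    (fun z hz => axisLipschitz_mono (le_max_left _ _) (min_le_left _ _) (hPV (hsing z hz).1))
    (fun z hz => axisLipschitz_mono (le_max_right _ _) (min_le_right _ _) (hQW (hsing z hz)))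
    (fun z hz => hPy z (hsing z hz).1.1.1) (fun z hz => hQx z (hsing z hz).1.1.1) hx hy

end LoomanMenchoff

section Closed

variable {E : Type*} [NormedAddCommGroup E] [NormedSpace ℝ E] [CompleteSpace E]
  {P Q D : ℝ × ℝ → E} {x₁ x₂ y₁ y₂ : ℝ}

theorem rectIntegral_comp_continuousLinearMap (hP : Continuous P) (hQ : Continuous Q)
    (ℓ : E →L[ℝ] ℝ) :
    rectIntegral (ℓ ∘ P) (ℓ ∘ Q) x₁ x₂ y₁ y₂ = ℓ (rectIntegral P Q x₁ x₂ y₁ y₂) := by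
  have hcomm : ∀ {f : ℝ → E}, Continuous f → ∀ a b, ∫ t in a..b, ℓ (f t) = ℓ (∫ t in a..b, f t) :=
    fun hf a b => ℓ.intervalIntegral_comp_comm (hf.intervalIntegrable a b)
  simp only [rectIntegral, Function.comp_apply, map_sub, map_add]
  rw [hcomm (by fun_prop), hcomm (by fun_prop), hcomm (by fun_prop), hcomm (by fun_prop)]

theorem rectIntegral_eq_zero_of_hasDerivAt (hx : x₁ ≤ x₂) (hy : y₁ ≤ y₂)
    (hP : ContinuousOn P (Icc x₁ x₂ ×ˢ Icc y₁ y₂)) (hQ : ContinuousOn Q (Icc x₁ x₂ ×ˢ Icc y₁ y₂))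
    (hPx : ∀ z ∈ Ioo x₁ x₂ ×ˢ Ioo y₁ y₂, DifferentiableAt ℝ (fun x => P (x, z.2)) z.1)
    (hPy : ∀ z ∈ Ioo x₁ x₂ ×ˢ Ioo y₁ y₂, HasDerivAt (fun y => P (z.1, y)) (D z) z.2)
    (hQx : ∀ z ∈ Ioo x₁ x₂ ×ˢ Ioo y₁ y₂, HasDerivAt (fun x => Q (x, z.2)) (D z) z.1)
    (hQy : ∀ z ∈ Ioo x₁ x₂ ×ˢ Ioo y₁ y₂, DifferentiableAt ℝ (fun y => Q (z.1, y)) z.2) :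
    rectIntegral P Q x₁ x₂ y₁ y₂ = 0 := by
  set c : ℝ × ℝ → ℝ × ℝ := fun z => (projIcc x₁ x₂ hx z.1, projIcc y₁ y₂ hy z.2)
  have hc : Continuous c := by fun_prop
  have hcR : ∀ z, c z ∈ Icc x₁ x₂ ×ˢ Icc y₁ y₂ := fun z => ⟨Subtype.prop _, Subtype.prop _⟩
  have hcid : EqOn c id (Icc x₁ x₂ ×ˢ Icc y₁ y₂) := fun z hz =>
    Prod.ext (by simp [c, projIcc_of_mem hx hz.1]) (by simp [c, projIcc_of_mem hy hz.2])
  have hclamp : ∀ f : ℝ × ℝ → E, EqOn f (f ∘ c) (Icc x₁ x₂ ×ˢ Icc y₁ y₂) := fun f z hz => by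
    rw [Function.comp_apply, hcid hz, id]
  have hfst : ∀ f : ℝ × ℝ → E, ∀ z ∈ Ioo x₁ x₂ ×ˢ Ioo y₁ y₂,
      (fun x => (f ∘ c) (x, z.2)) =ᶠ[𝓝 z.1] fun x => f (x, z.2) := fun f z hz => by
    filter_upwards [Ioo_mem_nhds hz.1.1 hz.1.2] with x hx'
    exact (hclamp f (x := (x, z.2)) ⟨Ioo_subset_Icc_self hx', Ioo_subset_Icc_self hz.2⟩).symm
  have hsnd : ∀ f : ℝ × ℝ → E, ∀ z ∈ Ioo x₁ x₂ ×ˢ Ioo y₁ y₂,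
      (fun y => (f ∘ c) (z.1, y)) =ᶠ[𝓝 z.2] fun y => f (z.1, y) := fun f z hz => by
    filter_upwards [Ioo_mem_nhds hz.2.1 hz.2.2] with y hy'
    exact (hclamp f (x := (z.1, y)) ⟨Ioo_subset_Icc_self hz.1, Ioo_subset_Icc_self hy'⟩).symm
  have hPc : Continuous (P ∘ c) := hP.comp_continuous hc hcR
  have hQc : Continuous (Q ∘ c) := hQ.comp_continuous hc hcR
  rw [rectIntegral_congr hx hy (hclamp P) (hclamp Q)]
  refine SeparatingDual.eq_zero_of_forall_dual_eq_zero (R := ℝ) fun ℓ => ?_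
  rw [← rectIntegral_comp_continuousLinearMap hPc hQc]
  have hℓP := ℓ.continuous.comp hPc
  have hℓQ := ℓ.continuous.comp hQc
  exact rectIntegral_eq_zero_of_Ioo_subset_closedLocus hℓP hℓQ hx hy
    (subset_closedLocus_of_hasDerivAt (D := ℓ ∘ D) hℓP hℓQ
      (isOpen_Ioo.prod isOpen_Ioo)
      (fun z hz => ℓ.differentiableAt.comp _ ((hPx z hz).congr_of_eventuallyEq (hfst P z hz)))
      (fun z hz => ℓ.hasFDerivAt.comp_hasDerivAt _ ((hPy z hz).congr_of_eventuallyEq (hsnd P z hz)))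
      (fun z hz => ℓ.hasFDerivAt.comp_hasDerivAt _ ((hQx z hz).congr_of_eventuallyEq (hfst Q z hz)))
      fun z hz => ℓ.differentiableAt.comp _ ((hQy z hz).congr_of_eventuallyEq (hsnd Q z hz)))

end Closed

section Segment

variable {A E : Type*} [NormedCommRing A] [NormedAlgebra ℝ A] [NormedAddCommGroup E]
  [NormedSpace ℝ E] {T : E →L[ℝ] A} {V : Set E} {Ψ d : E → A} {x y z : E}

/-- `Ψ` has at the points of `V` the derivative `d` along the values of `T`: its derivative in the
direction `h` is `T h * d`. For a monogenic function `T` is the coordinate parametrization of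
`E_k`. -/
def HasDirectionalDerivOn (T : E →L[ℝ] A) (V : Set E) (Ψ d : E → A) : Prop :=
  ∀ x ∈ V, ∀ h : E, HasLineDerivAt ℝ Ψ (T h * d x) x h

theorem HasDirectionalDerivOn.hasDerivAt (hΨ : HasDirectionalDerivOn T V Ψ d) (h : E) {s : ℝ}
    (hs : x + s • h ∈ V) :
    HasDerivAt (fun s : ℝ => Ψ (x + s • h)) (T h * d (x + s • h)) s := by
  have h₀ : HasDerivAt (fun t : ℝ => Ψ (x + s • h + t • h)) (T h * d (x + s • h)) 0 := hΨ _ hs h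
  rw [← sub_self s] at h₀
  refine (h₀.comp_sub_const s s).congr_of_eventuallyEq (Eventually.of_forall fun s' => ?_)
  simp only [add_assoc, ← add_smul, add_sub_cancel]

/-- The integral of `Ψ dT` along the segment from `x` to `y`. -/
noncomputable def segIntegral (T : E →L[ℝ] A) (Ψ : E → A) (x y : E) : A :=
  ∫ t in (0 : ℝ)..1, Ψ (x + t • (y - x)) * T (y - x)

theorem norm_segIntegral_le (hV : Convex ℝ V) (hx : x ∈ V) (hy : y ∈ V) {η : ℝ}
    (hη : ∀ w ∈ V, ‖Ψ w‖ ≤ η) : ‖segIntegral T Ψ x y‖ ≤ η * ‖T (y - x)‖ := by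
  refine (intervalIntegral.norm_integral_le_of_norm_le_const (C := η * ‖T (y - x)‖)
    fun t ht => ?_).trans (by simp)
  rw [uIoc_of_le zero_le_one] at ht
  exact (norm_mul_le _ _).trans (mul_le_mul_of_nonneg_right
    (hη _ (hV.add_smul_sub_mem hx hy (Ioc_subset_Icc_self ht))) (norm_nonneg _))

variable [CompleteSpace A]

-- The triangle is the image of the unit square under `(s, t) ↦ x + s • (u + t • v)`; the pull-back
-- of `Ψ dT` to the square is closed, and vanishes on the side `s = 0`.
theorem segIntegral_add (hc : ContinuousOn Ψ V) (hΨ : HasDirectionalDerivOn T V Ψ d)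
    (hV : Convex ℝ V) (hx : x ∈ V) (hy : y ∈ V) (hz : z ∈ V) :
    segIntegral T Ψ x y + segIntegral T Ψ y z = segIntegral T Ψ x z := by
  set u := y - x with hu
  set v := z - y with hv
  set φ : ℝ × ℝ → E := fun p => x + p.1 • (u + p.2 • v) with hφ
  have hmem : ∀ p ∈ Icc (0 : ℝ) 1 ×ˢ Icc (0 : ℝ) 1, φ p ∈ V := fun p hp => by
    have hp' := hV.add_smul_sub_mem hx (hV.add_smul_sub_mem hy hz hp.2) hp.1
    rwa [add_sub_right_comm] at hp'
  have hmem' : ∀ p ∈ Ioo (0 : ℝ) 1 ×ˢ Ioo (0 : ℝ) 1, φ p ∈ V := fun p hp =>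
    hmem p ⟨Ioo_subset_Icc_self hp.1, Ioo_subset_Icc_self hp.2⟩
  have hΨφ : ContinuousOn (Ψ ∘ φ) (Icc 0 1 ×ˢ Icc 0 1) := hc.comp (by fun_prop) hmem
  have hs : ∀ p ∈ Ioo (0 : ℝ) 1 ×ˢ Ioo (0 : ℝ) 1,
      HasDerivAt (fun s => Ψ (φ (s, p.2))) (T (u + p.2 • v) * d (φ p)) p.1 := fun p hp =>
    hΨ.hasDerivAt _ (hmem' p hp)
  have ht : ∀ p ∈ Ioo (0 : ℝ) 1 ×ˢ Ioo (0 : ℝ) 1,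
      HasDerivAt (fun t => Ψ (φ (p.1, t))) (T (p.1 • v) * d (φ p)) p.2 := fun p hp => by
    have hφt : ∀ t, φ (p.1, t) = x + p.1 • u + t • p.1 • v := fun t => by
      simp only [hφ, smul_add, smul_comm p.1 t v, add_assoc]
    have hp' := hmem' p hp
    rw [hφt p.2] at hp' ⊢
    simpa only [hφt] using hΨ.hasDerivAt _ hp'
  have hTt : ∀ t : ℝ, HasDerivAt (fun t => T (u + t • v)) (T v) t := fun t => by
    have h := ((hasDerivAt_id t).smul_const v).const_add u
    rw [one_smul] at h
    exact T.hasFDerivAt.comp_hasDerivAt t h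
  have hTs : ∀ s : ℝ, HasDerivAt (fun s => s • T v) (T v) s := fun s => by
    simpa using (hasDerivAt_id s).smul_const (T v)
  have hsquare := rectIntegral_eq_zero_of_hasDerivAt zero_le_one zero_le_one
    (P := fun p => Ψ (φ p) * T (u + p.2 • v)) (Q := fun p => Ψ (φ p) * p.1 • T v)
    (D := fun p => T (p.1 • v) * d (φ p) * T (u + p.2 • v) + Ψ (φ p) * T v)
    (hΨφ.mul (by fun_prop)) (hΨφ.mul (by fun_prop))
    (fun p hp => ((hs p hp).mul_const (T (u + p.2 • v))).differentiableAt)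
    (fun p hp => (ht p hp).mul (hTt p.2))
    (fun p hp => ((hs p hp).mul (hTs p.1)).congr_deriv ?_)
    fun p hp => ((ht p hp).mul_const (p.1 • T v)).differentiableAt
  · have hyz : ∀ t : ℝ, x + (u + t • v) = y + t • v := fun t => by rw [← add_assoc, hu]; simp
    have huv : u + v = z - x := by rw [hu, hv, add_comm, sub_add_sub_cancel]
    simpa only [segIntegral, rectIntegral, hφ, zero_smul, one_smul, mul_zero, add_zero, sub_zero,
      intervalIntegral.integral_zero, sub_eq_zero, hyz, huv] using hsquare
  · simp only [map_smul, smul_mul_assoc, mul_smul_comm]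
    ring_nf

theorem segIntegral_sub_const (hc : ContinuousOn Ψ V) (hV : Convex ℝ V) (hx : x ∈ V) (hy : y ∈ V)
    (c : A) :
    segIntegral T Ψ x y - c * T (y - x) = segIntegral T (fun w => Ψ w - c) x y := by
  have hint : IntervalIntegrable (fun t : ℝ => Ψ (x + t • (y - x)) * T (y - x)) volume 0 1 := by
    refine ContinuousOn.intervalIntegrable ?_
    rw [uIcc_of_le zero_le_one]
    exact (hc.comp (by fun_prop) fun t ht => hV.add_smul_sub_mem hx hy ht).mul continuousOn_const
  simp only [segIntegral, sub_mul]
  rw [intervalIntegral.integral_sub hint intervalIntegrable_const, intervalIntegral.integral_const,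
    sub_zero, one_smul]

end Segment

section Primitive

theorem exists_sub_eq_of_additive {X G : Type*} [SeminormedAddCommGroup X] [NormedSpace ℝ X]
    [AddCommGroup G] {K : Set X} (hK : Bornology.IsBounded K) (hstar : StarConvex ℝ 0 K)
    {I : X → X → G} {δ : ℝ} (hδ : 0 < δ)
    (hI : ∀ a ∈ K, ∀ b ∈ K, ∀ c ∈ K, dist b a < δ → dist c a < δ → I a b + I b c = I a c) :
    ∃ g : X → G, ∀ p ∈ K, ∀ q ∈ K, dist q p < δ / 2 → g q - g p = I p q := by
  obtain ⟨M, hM⟩ := hK.exists_norm_le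
  obtain ⟨n, hn⟩ := exists_nat_gt (max 0 (M / (δ / 2)))
  obtain ⟨hn₀, hMn⟩ := max_lt_iff.1 hn
  rw [div_lt_comm₀ (half_pos hδ) hn₀] at hMn
  set σ : ℕ → X → X := fun j p => ((j : ℝ) / n) • p with hσ
  have hratio : ∀ j ≤ n, (j : ℝ) / n ≤ 1 := fun j hj => div_le_one_of_le₀ (by simpa) hn₀.le
  have hσK : ∀ j ≤ n, ∀ p ∈ K, σ j p ∈ K := fun j hj p hp =>
    hstar.smul_mem hp (by positivity) (hratio j hj)
  have hstep : ∀ j, ∀ p ∈ K, dist (σ (j + 1) p) (σ j p) < δ / 2 := fun j p hp => by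
    rw [dist_eq_norm, ← sub_smul, norm_smul, ← sub_div, Nat.cast_succ, add_sub_cancel_left,
      Real.norm_of_nonneg (by positivity), one_div_mul_eq_div]
    exact (div_le_div_of_nonneg_right (hM p hp) hn₀.le).trans_lt hMn
  have hpar : ∀ j ≤ n, ∀ p q, dist (σ j q) (σ j p) ≤ dist q p := fun j hj p q => by
    rw [dist_smul₀, Real.norm_of_nonneg (by positivity)]
    exact mul_le_of_le_one_left dist_nonneg (hratio j hj)
  have hrefl : ∀ a ∈ K, I a a = 0 := fun a ha =>
    left_eq_add.1 (hI a ha a ha a ha (by simpa) (by simpa)).symm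
  refine ⟨fun p => ∑ j ∈ Finset.range n, I (σ j p) (σ (j + 1) p), fun p hp q hq hpq => ?_⟩
  have hquad : ∀ j ∈ Finset.range n, I (σ j q) (σ (j + 1) q) - I (σ j p) (σ (j + 1) p) =
      I (σ (j + 1) p) (σ (j + 1) q) - I (σ j p) (σ j q) := fun j hj => by
    have hj' := Finset.mem_range.1 hj
    have hbase := hσK j hj'.le p hp
    have hup := hstep j p hp
    have hright := (hpar j hj'.le p q).trans_lt hpq
    have hdiag : dist (σ (j + 1) q) (σ j p) < δ :=
      (dist_triangle _ (σ j q) _).trans_lt (by linarith [hstep j q hq])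
    have h₁ := hI _ hbase _ (hσK (j + 1) hj' p hp) _ (hσK (j + 1) hj' q hq) (by linarith) hdiag
    have h₂ := hI _ hbase _ (hσK j hj'.le q hq) _ (hσK (j + 1) hj' q hq) (by linarith) hdiag
    rw [sub_eq_sub_iff_add_eq_add, add_comm (I (σ j q) _), h₂, add_comm (I (σ (j + 1) p) _), h₁]
  have hσ₀ : ∀ p, σ 0 p = 0 := fun p => by simp [hσ]
  have hσn : ∀ p, σ n p = p := fun p => by simp [hσ, hn₀.ne']
  rw [← Finset.sum_sub_distrib, Finset.sum_congr rfl hquad,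
    Finset.sum_range_sub fun j => I (σ j p) (σ j q), hσn, hσn, hσ₀, hσ₀,
    hrefl 0 (hσ₀ p ▸ hσK 0 (Nat.zero_le n) p hp), sub_zero]

theorem exists_ball_subset_of_isCompact {X E : Type*} [PseudoMetricSpace X] [PseudoMetricSpace E]
    {K : Set X} {U : Set E} {H : X → E} (hK : IsCompact K) (hU : IsOpen U) (hH : ContinuousOn H K)
    (hHU : MapsTo H K U) :
    ∃ r > 0, ∃ δ > 0, ∀ p ∈ K, ball (H p) r ⊆ U ∧
      ∀ q ∈ K, dist q p < δ → H q ∈ ball (H p) r := by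
  obtain ⟨r, hr, hrU⟩ := (hK.image_of_continuousOn hH).exists_thickening_subset_open hU
    hHU.image_subset
  obtain ⟨δ, hδ, hHδ⟩ := Metric.uniformContinuousOn_iff.1
    (hK.uniformContinuousOn_of_continuous hH) r hr
  exact ⟨r, hr, δ, hδ, fun p hp => ⟨(ball_subset_thickening (mem_image_of_mem H hp) r).trans hrU,
    fun q hq hqp => hHδ q hq p hp hqp⟩⟩

variable {A E X : Type*} [NormedCommRing A] [NormedAlgebra ℝ A] [CompleteSpace A]
  [NormedAddCommGroup E] [NormedSpace ℝ E] [SeminormedAddCommGroup X] [NormedSpace ℝ X]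

theorem exists_primitive {T : E →L[ℝ] A} {U : Set E} {Ψ d : E → A} {K : Set X} {H : X → E}
    (hU : IsOpen U) (hc : ContinuousOn Ψ U) (hΨ : HasDirectionalDerivOn T U Ψ d) (hK : IsCompact K)
    (hstar : StarConvex ℝ 0 K) (hH : ContinuousOn H K) (hHU : MapsTo H K U) :
    ∃ g : X → A, ∃ δ > 0, ∀ p ∈ K, ∀ q ∈ K, dist q p < δ →
      g q - g p = segIntegral T Ψ (H p) (H q) := by
  obtain ⟨r, hr, δ, hδ, hball⟩ := exists_ball_subset_of_isCompact hK hU hH hHU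
  obtain ⟨g, hg⟩ := exists_sub_eq_of_additive (I := fun p q => segIntegral T Ψ (H p) (H q))
    hK.isBounded hstar hδ fun a ha b hb c hc' hba hca =>
      segIntegral_add (hc.mono (hball a ha).1) (fun x hx => hΨ x ((hball a ha).1 hx))
        (convex_ball (H a) r) (mem_ball_self hr) ((hball a ha).2 b hb hba)
        ((hball a ha).2 c hc' hca)
  exact ⟨g, δ / 2, half_pos hδ, hg⟩

end Primitive

section Stieltjes

/-- A partition of `[0, 1]` into `size` intervals `[node i, node (i + 1)]` with tags `tag i`. The
values of `node` beyond `size` and of `tag` from `size` on are irrelevant. -/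
structure TaggedPartition where
  size : ℕ
  node : ℕ → ℝ
  tag : ℕ → ℝ
  node_zero : node 0 = 0
  node_size : node size = 1
  node_le_tag : ∀ i < size, node i ≤ tag i
  tag_le_node : ∀ i < size, tag i ≤ node (i + 1)

namespace TaggedPartition

variable (P : TaggedPartition)

/-- The mesh of the partition is less than `δ`. -/
def MeshLT (δ : ℝ) : Prop := ∀ i < P.size, P.node (i + 1) - P.node i < δ

/-- The filter on tagged partitions of the mesh tending to zero. -/
def fine : Filter TaggedPartition := ⨅ δ > 0, 𝓟 {P | P.MeshLT δ}

theorem hasBasis_fine : fine.HasBasis (fun δ : ℝ => 0 < δ) fun δ => {P | P.MeshLT δ} :=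
  hasBasis_biInf_principal'
    (fun δ hδ δ' hδ' => ⟨min δ δ', lt_min hδ hδ',
      fun _ hP i hi => (hP i hi).trans_le (min_le_left _ _),
      fun _ hP i hi => (hP i hi).trans_le (min_le_right _ _)⟩) ⟨1, one_pos⟩

/-- The partition into `n + 1` intervals of equal length, tagged by their left endpoints. -/
noncomputable def uniform (n : ℕ) : TaggedPartition where
  size := n + 1
  node i := i / (n + 1)
  tag i := i / (n + 1)
  node_zero := by simp
  node_size := by rw [Nat.cast_succ, div_self (by positivity)]
  node_le_tag _ _ := le_rfl
  tag_le_node i _ := by gcongr; simp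

instance neBot_fine : fine.NeBot := hasBasis_fine.neBot_iff.2 fun hδ => by
  obtain ⟨n, hn⟩ := exists_nat_one_div_lt hδ
  refine ⟨uniform n, fun i _ => ?_⟩
  simpa only [uniform, ← sub_div, Nat.cast_succ, add_sub_cancel_left] using hn

variable {P}

theorem monotoneOn_node : MonotoneOn P.node (Iic P.size) :=
  monotoneOn_of_le_succ ordConnected_Iic fun i _ _ hi =>
    (P.node_le_tag i (Nat.lt_of_succ_le hi)).trans (P.tag_le_node i (Nat.lt_of_succ_le hi))

theorem node_mem_Icc {i : ℕ} (hi : i ≤ P.size) : P.node i ∈ Icc (0 : ℝ) 1 :=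
  ⟨P.node_zero ▸ P.monotoneOn_node (Nat.zero_le _) hi (Nat.zero_le i),
    P.node_size ▸ P.monotoneOn_node hi self_mem_Iic hi⟩

theorem tag_mem_Icc {i : ℕ} (hi : i < P.size) : P.tag i ∈ Icc (0 : ℝ) 1 :=
  ⟨(node_mem_Icc hi.le).1.trans (P.node_le_tag i hi),
    (P.tag_le_node i hi).trans (node_mem_Icc (Nat.succ_le_of_lt hi)).2⟩

theorem sum_norm_sub_le {E : Type*} [SeminormedAddCommGroup E] {g : ℝ → E}
    (hg : BoundedVariationOn g (Icc 0 1)) :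
    ∑ i ∈ Finset.range P.size, ‖g (P.node (i + 1)) - g (P.node i)‖ ≤
      (eVariationOn g (Icc 0 1)).toReal := by
  have hsum := eVariationOn.sum_le_of_monotoneOn_Iic (f := g) P.monotoneOn_node
    fun i hi => node_mem_Icc hi
  simpa only [edist_dist, dist_eq_norm, ENNReal.ofReal_le_iff_le_toReal hg,
    ← ENNReal.ofReal_sum_of_nonneg fun _ _ => norm_nonneg _] using hsum

end TaggedPartition

/-- The Riemann–Stieltjes sum of `f dg` over a tagged partition. -/
def stieltjesSum {A : Type*} [Ring A] (f g : ℝ → A) (P : TaggedPartition) : A :=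
  ∑ i ∈ Finset.range P.size, f (P.tag i) * (g (P.node (i + 1)) - g (P.node i))

/-- The Riemann–Stieltjes integral of `f dg` over `[0, 1]` exists and equals `I`. -/
def HasStieltjesIntegral {A : Type*} [Ring A] [TopologicalSpace A] (f g : ℝ → A) (I : A) : Prop :=
  Tendsto (stieltjesSum f g) TaggedPartition.fine (𝓝 I)

namespace HasStieltjesIntegral

section Ring

variable {A : Type*} [Ring A] [TopologicalSpace A] {f f' g g' : ℝ → A} {I J : A}

theorem unique [T2Space A] (hI : HasStieltjesIntegral f g I) (hJ : HasStieltjesIntegral f g J) :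
    I = J :=
  tendsto_nhds_unique hI hJ

theorem congr (hI : HasStieltjesIntegral f g I)
    (h : ∀ s ∈ Icc (0 : ℝ) 1, ∀ t ∈ Icc (0 : ℝ) 1, ∀ t' ∈ Icc (0 : ℝ) 1,
      f s * (g t' - g t) = f' s * (g' t' - g' t)) : HasStieltjesIntegral f' g' I :=
  Tendsto.congr (fun P => Finset.sum_congr rfl fun i hi => by
    have hi' := Finset.mem_range.1 hi
    exact h _ (P.tag_mem_Icc hi') _ (P.node_mem_Icc hi'.le) _ (P.node_mem_Icc hi')) hI

theorem const_mul [ContinuousMul A] (hI : HasStieltjesIntegral f g I) (a : A) :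
    HasStieltjesIntegral (fun t => a * f t) g (a * I) :=
  (Tendsto.const_mul a hI).congr fun P => by
    simp only [stieltjesSum, Finset.mul_sum, mul_assoc]

end Ring

variable {A : Type*} [NormedRing A] {f g : ℝ → A} {I J : A}

theorem norm_sub_le {f' : ℝ → A} (hI : HasStieltjesIntegral f g I)
    (hJ : HasStieltjesIntegral f' g J) (hg : BoundedVariationOn g (Icc 0 1)) {η : ℝ} (hη : 0 ≤ η)
    (h : ∀ t ∈ Icc (0 : ℝ) 1, ‖f t - f' t‖ ≤ η) :
    ‖I - J‖ ≤ η * (eVariationOn g (Icc 0 1)).toReal := by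
  refine le_of_tendsto (Tendsto.sub hI hJ).norm (Eventually.of_forall fun P => ?_)
  calc ‖stieltjesSum f g P - stieltjesSum f' g P‖
      = ‖∑ i ∈ Finset.range P.size,
          (f (P.tag i) - f' (P.tag i)) * (g (P.node (i + 1)) - g (P.node i))‖ := by
        simp only [stieltjesSum, ← Finset.sum_sub_distrib, sub_mul]
    _ ≤ ∑ i ∈ Finset.range P.size, η * ‖g (P.node (i + 1)) - g (P.node i)‖ :=
        norm_sum_le_of_le _ fun i hi => (norm_mul_le _ _).trans <| by
          gcongr
          exact h _ (P.tag_mem_Icc (Finset.mem_range.1 hi))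
    _ ≤ η * (eVariationOn g (Icc 0 1)).toReal := by
        rw [← Finset.mul_sum]
        gcongr
        exact P.sum_norm_sub_le hg

theorem tendsto {ι : Type*} {l : Filter ι} {F : ι → ℝ → A} {J : ι → A}
    (hJ : ∀ᶠ r in l, HasStieltjesIntegral (F r) g (J r)) (hI : HasStieltjesIntegral f g I)
    (hg : BoundedVariationOn g (Icc 0 1)) (hF : TendstoUniformlyOn F f l (Icc 0 1)) :
    Tendsto J l (𝓝 I) := by
  refine Metric.tendsto_nhds.2 fun η hη => ?_
  set v := (eVariationOn g (Icc 0 1)).toReal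
  have : 0 ≤ v := ENNReal.toReal_nonneg
  have hκ : 0 < η / (v + 1) := by positivity
  filter_upwards [hJ, Metric.tendstoUniformlyOn_iff.1 hF _ hκ] with r hr hFr
  rw [dist_comm, dist_eq_norm]
  calc ‖I - J r‖ ≤ η / (v + 1) * v := hI.norm_sub_le hr hg hκ.le fun t ht =>
        (dist_eq_norm (f t) (F r t)).symm.trans_le (hFr t ht).le
    _ < η / (v + 1) * (v + 1) := by gcongr; exact lt_add_one v
    _ = η := div_mul_cancel₀ _ (by positivity)

theorem of_forall_norm_sub_le {G : ℝ → A} (hg : BoundedVariationOn g (Icc 0 1))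
    (hG : ∀ η > 0, ∃ δ > 0, ∀ τ ∈ Icc (0 : ℝ) 1, ∀ s ∈ Icc (0 : ℝ) 1, ∀ t ∈ Icc (0 : ℝ) 1,
      dist s τ < δ → dist t τ < δ → ‖G t - G s - f τ * (g t - g s)‖ ≤ η * ‖g t - g s‖) :
    HasStieltjesIntegral f g (G 1 - G 0) := by
  refine (TaggedPartition.hasBasis_fine.tendsto_iff nhds_basis_ball).2 fun η hη => ?_
  set v := (eVariationOn g (Icc 0 1)).toReal
  have : 0 ≤ v := ENNReal.toReal_nonneg
  have hκ : 0 < η / (v + 1) := by positivity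
  obtain ⟨δ, hδ, hδG⟩ := hG _ hκ
  refine ⟨δ, hδ, fun P hP => ?_⟩
  have hterm : ∀ i ∈ Finset.range P.size,
      ‖G (P.node (i + 1)) - G (P.node i) - f (P.tag i) * (g (P.node (i + 1)) - g (P.node i))‖ ≤
        η / (v + 1) * ‖g (P.node (i + 1)) - g (P.node i)‖ := fun i hi => by
    have hi' := Finset.mem_range.1 hi
    have hmesh := hP i hi'
    have hleft := P.node_le_tag i hi'
    have hright := P.tag_le_node i hi'
    refine hδG _ (P.tag_mem_Icc hi') _ (P.node_mem_Icc hi'.le) _ (P.node_mem_Icc hi') ?_ ?_ <;>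
      rw [Real.dist_eq, abs_lt] <;> constructor <;> linarith
  have htel : G 1 - G 0 = ∑ i ∈ Finset.range P.size, (G (P.node (i + 1)) - G (P.node i)) := by
    rw [Finset.sum_range_sub fun i => G (P.node i), P.node_zero, P.node_size]
  rw [mem_ball, dist_comm, dist_eq_norm, htel, stieltjesSum, ← Finset.sum_sub_distrib]
  calc _ ≤ ∑ i ∈ Finset.range P.size, η / (v + 1) * ‖g (P.node (i + 1)) - g (P.node i)‖ :=
        norm_sum_le_of_le _ hterm
    _ ≤ η / (v + 1) * v := by
        rw [← Finset.mul_sum]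
        gcongr
        exact P.sum_norm_sub_le hg
    _ < η / (v + 1) * (v + 1) := by gcongr; exact lt_add_one v
    _ = η := div_mul_cancel₀ _ (by positivity)

end HasStieltjesIntegral

end Stieltjes

section Homotopy

variable {A E : Type*} [NormedCommRing A] [NormedAlgebra ℝ A] [CompleteSpace A]

theorem hasStieltjesIntegral_of_primitive [NormedAddCommGroup E] [NormedSpace ℝ E] {T : E →L[ℝ] A}
    {U : Set E} {Ψ : E → A} (hU : IsOpen U) (hΨ : ContinuousOn Ψ U) {γ : ℝ → E}
    (hγ : ContinuousOn γ (Icc 0 1)) (hγU : MapsTo γ (Icc 0 1) U)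
    (hγv : BoundedVariationOn γ (Icc 0 1)) {G : ℝ → A} {δ : ℝ} (hδ : 0 < δ)
    (hG : ∀ s ∈ Icc (0 : ℝ) 1, ∀ t ∈ Icc (0 : ℝ) 1, dist t s < δ →
      G t - G s = segIntegral T Ψ (γ s) (γ t)) :
    HasStieltjesIntegral (Ψ ∘ γ) (T ∘ γ) (G 1 - G 0) := by
  refine .of_forall_norm_sub_le (T.lipschitz.comp_boundedVariationOn hγv) fun η hη => ?_
  set W : Set (E × E) := U ×ˢ U ∩ (fun w => dist (Ψ w.1) (Ψ w.2)) ⁻¹' Iio η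
  have hΨ₁ : ContinuousOn (fun w : E × E => Ψ w.1) (U ×ˢ U) :=
    hΨ.comp continuousOn_fst fun _ hw => hw.1
  have hΨ₂ : ContinuousOn (fun w : E × E => Ψ w.2) (U ×ˢ U) :=
    hΨ.comp continuousOn_snd fun _ hw => hw.2
  have hW : IsOpen W := (continuous_dist.comp_continuousOn (hΨ₁.prodMk hΨ₂)).isOpen_inter_preimage
    (hU.prod hU) isOpen_Iio
  obtain ⟨r, hr, δ', hδ', hball⟩ := exists_ball_subset_of_isCompact isCompact_Icc hW
    (hγ.prodMk hγ) fun t ht => ⟨⟨hγU ht, hγU ht⟩, by simpa using hη⟩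
  refine ⟨min (δ / 2) δ', by positivity, fun τ hτ s hs t ht hsτ htτ => ?_⟩
  obtain ⟨hsδ, hsδ'⟩ := lt_min_iff.1 hsτ
  obtain ⟨htδ, htδ'⟩ := lt_min_iff.1 htτ
  have hBW : ∀ w ∈ ball (γ τ) r, (w, γ τ) ∈ W := fun w hw => (hball τ hτ).1 <| by
    rw [← ball_prod_same]
    exact ⟨hw, mem_ball_self hr⟩
  have hγB : ∀ q ∈ Icc (0 : ℝ) 1, dist q τ < δ' → γ q ∈ ball (γ τ) r := fun q hq hqτ => by
    have hq' := (hball τ hτ).2 q hq hqτ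
    rw [← ball_prod_same] at hq'
    exact hq'.1
  have hst : dist t s < δ := (dist_triangle_right t s τ).trans_lt (by linarith)
  rw [hG s hs t ht hst, Function.comp_apply, Function.comp_apply, Function.comp_apply, ← map_sub,
    segIntegral_sub_const (hΨ.mono fun w hw => (hBW w hw).1.1) (convex_ball _ _)
      (hγB s hs hsδ') (hγB t ht htδ')]
  exact norm_segIntegral_le (convex_ball _ _) (hγB s hs hsδ') (hγB t ht htδ') fun w hw =>
    (dist_eq_norm _ _).symm.trans_le (hBW w hw).2.le

theorem exists_hasStieltjesIntegral_of_closedHomotopicIn {k : ℕ} {T : Coord k →L[ℝ] A}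
    {U : Set (Coord k)} {Ψ d : Coord k → A} (hU : IsOpen U) (hc : ContinuousOn Ψ U)
    (hΨ : HasDirectionalDerivOn T U Ψ d) {γ₀ γ₁ : ℝ → Coord k}
    (hγ₀ : BoundedVariationOn γ₀ (Icc 0 1)) (hγ₁ : BoundedVariationOn γ₁ (Icc 0 1))
    (hγ : ClosedHomotopicIn U γ₀ γ₁) :
    ∃ I, HasStieltjesIntegral (Ψ ∘ γ₀) (T ∘ γ₀) I ∧ HasStieltjesIntegral (Ψ ∘ γ₁) (T ∘ γ₁) I := by
  obtain ⟨H, hH, hHU, hH₀, hH₁, hclosed⟩ := hγ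
  have h₀ : (0 : ℝ) ∈ Icc (0 : ℝ) 1 := left_mem_Icc.2 zero_le_one
  have h₁ : (1 : ℝ) ∈ Icc (0 : ℝ) 1 := right_mem_Icc.2 zero_le_one
  obtain ⟨g, δ, hδ, hg⟩ := exists_primitive hU hc hΨ
    (isCompact_Icc.prod isCompact_Icc : IsCompact (Icc (0 : ℝ) 1 ×ˢ Icc (0 : ℝ) 1))
    (((convex_Icc _ _).prod (convex_Icc _ _)).starConvex ⟨h₀, h₀⟩) hH hHU
  have hstage : ∀ s ∈ Icc (0 : ℝ) 1, ∀ γ : ℝ → Coord k, (∀ t ∈ Icc (0 : ℝ) 1, H (s, t) = γ t) →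
      BoundedVariationOn γ (Icc 0 1) →
      HasStieltjesIntegral (Ψ ∘ γ) (T ∘ γ) (g (s, 1) - g (s, 0)) := fun s hs γ hHγ hγ => by
    refine hasStieltjesIntegral_of_primitive (G := fun t => g (s, t)) hU hc
      ((hH.comp (by fun_prop) fun t ht => ⟨hs, ht⟩).congr fun t ht => (hHγ t ht).symm)
      (fun t ht => hHγ t ht ▸ hHU ⟨hs, ht⟩) hγ hδ fun p hp q hq hpq => ?_
    rw [← hHγ p hp, ← hHγ q hq]
    exact hg _ ⟨hs, hp⟩ _ ⟨hs, hq⟩ (by simpa [Prod.dist_eq, hδ] using hpq)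
  have hlocal : ∀ s ∈ Icc (0 : ℝ) 1, ∀ s' ∈ Icc (0 : ℝ) 1, dist s' s < δ →
      g (s', 1) - g (s', 0) = g (s, 1) - g (s, 0) := fun s hs s' hs' hss' => by
    have hleft := hg (s, 0) ⟨hs, h₀⟩ (s', 0) ⟨hs', h₀⟩ (by simpa [Prod.dist_eq, hδ] using hss')
    have hright := hg (s, 1) ⟨hs, h₁⟩ (s', 1) ⟨hs', h₁⟩ (by simpa [Prod.dist_eq, hδ] using hss')
    rw [← hclosed s hs, ← hclosed s' hs', ← hleft] at hright
    linear_combination hright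
  have hconst : g (0, 1) - g (0, 0) = g (1, 1) - g (1, 0) :=
    isPreconnected_Icc.induction₂' (fun s s' => g (s, 1) - g (s, 0) = g (s', 1) - g (s', 0))
      (fun s hs => by
        filter_upwards [self_mem_nhdsWithin, mem_nhdsWithin_of_mem_nhds (ball_mem_nhds s hδ)]
          with s' hs' hss'
        exact ⟨(hlocal s hs s' hs' hss').symm, hlocal s hs s' hs' hss'⟩)
      (fun _ _ _ _ _ _ => Eq.trans) h₀ h₁
  exact ⟨_, hstage 0 h₀ γ₀ hH₀ hγ₀, hconst ▸ hstage 1 h₁ γ₁ hH₁ hγ₁⟩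

end Homotopy

section RegularSet

theorem continuousOn_ringInverse {A X : Type*} [NormedRing A] [CompleteSpace A]
    [TopologicalSpace X] {f : X → A} {s : Set X} (hf : ContinuousOn f s)
    (hu : ∀ x ∈ s, IsUnit (f x)) : ContinuousOn (fun x => Ring.inverse (f x)) s := fun x hx => by
  obtain ⟨u, hux⟩ := hu x hx
  exact (hux ▸ NormedRing.inverse_continuousAt u).comp_continuousWithinAt (hf x hx)

variable {A E : Type*} [NormedCommRing A] [NormedAlgebra ℝ A] [CompleteSpace A]
  [NormedAddCommGroup E] [NormedSpace ℝ E] {T : E →L[ℝ] A} {Ω : Set E} {Φ d : E → A} {x₀ : E}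

/-- The points `x` of `Ω` at which the Cauchy kernel with pole `x₀`, the inverse of `T x - T x₀`,
is defined. -/
def regularSet (T : E →L[ℝ] A) (Ω : Set E) (x₀ : E) : Set E :=
  {x ∈ Ω | IsUnit (T x - T x₀)}

theorem isOpen_regularSet (hΩ : IsOpen Ω) : IsOpen (regularSet T Ω x₀) :=
  hΩ.inter (Units.isOpen.preimage (by fun_prop : Continuous fun x => T x - T x₀))

theorem continuousOn_mul_inverse (hΦ : ContinuousOn Φ Ω) :
    ContinuousOn (fun x => Φ x * Ring.inverse (T x - T x₀)) (regularSet T Ω x₀) :=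
  (hΦ.mono fun _ hx => hx.1).mul (continuousOn_ringInverse (by fun_prop) fun _ hx => hx.2)

theorem HasDirectionalDerivOn.mul_inverse (hΦ : HasDirectionalDerivOn T Ω Φ d) :
    HasDirectionalDerivOn T (regularSet T Ω x₀) (fun x => Φ x * Ring.inverse (T x - T x₀))
      (fun x => d x * Ring.inverse (T x - T x₀) - Φ x * Ring.inverse (T x - T x₀) ^ 2) := by
  rintro x ⟨hxΩ, u, hu⟩ h
  have hinv : HasFDerivAt Ring.inverse (-ContinuousLinearMap.mulLeftRight ℝ A ↑u⁻¹ ↑u⁻¹)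
      (T x - T x₀) := hu ▸ hasFDerivAt_ringInverse u
  have hline := (hinv.comp x (T.hasFDerivAt.sub_const (T x₀))).hasLineDerivAt h
  have hmul := HasDerivAt.mul (hΦ x hxΩ h) hline
  refine hmul.congr_deriv ?_
  simp only [Function.comp_apply, zero_smul, add_zero, ← hu, Ring.inverse_unit,
    ContinuousLinearMap.comp_apply, neg_apply, ContinuousLinearMap.mulLeftRight_apply]
  ring

end RegularSet

section Formula

variable {A : Type*} [NormedCommRing A] [NormedAlgebra ℝ A] {k : ℕ}
  {T : Coord k →L[ℝ] A} {Ω : Set (Coord k)} {Φ d : Coord k → A} {x₀ : Coord k}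
  {γ c : ℝ → Coord k}

theorem ClosedHomotopicIn.mono {U V : Set (Coord k)} {γ₀ γ₁ : ℝ → Coord k}
    (h : ClosedHomotopicIn U γ₀ γ₁) (hUV : U ⊆ V) : ClosedHomotopicIn V γ₀ γ₁ :=
  let ⟨H, hH, hHU, hends⟩ := h
  ⟨H, hH, hHU.mono_right hUV, hends⟩

theorem closedHomotopicIn_smul {U : Set (Coord k)} (hc : ContinuousOn c (Icc 0 1))
    (hc₀₁ : c 0 = c 1) {r : ℝ} (hr : r ≤ 1)
    (hU : ∀ s ∈ Icc r 1, ∀ t ∈ Icc (0 : ℝ) 1, x₀ + s • c t ∈ U) :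
    ClosedHomotopicIn U (fun t => x₀ + c t) (fun t => x₀ + r • c t) := by
  have hc₂ : ContinuousOn (fun p : ℝ × ℝ => c p.2) (Icc 0 1 ×ˢ Icc 0 1) :=
    hc.comp continuousOn_snd fun _ hp => hp.2
  have hscale : Continuous fun p : ℝ × ℝ => 1 - p.1 * (1 - r) := by fun_prop
  refine ⟨fun p => x₀ + (1 - p.1 * (1 - r)) • c p.2,
    continuousOn_const.add (hscale.continuousOn.smul hc₂),
    fun p ⟨hs, ht⟩ => hU _ ⟨?_, ?_⟩ _ ht,
    fun t _ => by simp, fun t _ => by simp, fun s _ => by simp only [hc₀₁]⟩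
  · linarith [mul_le_of_le_one_left (sub_nonneg.2 hr) hs.2]
  · linarith [mul_nonneg hs.1 (sub_nonneg.2 hr)]

-- The factors `r` of `dζ` and of `ζ - ζ₀` cancel.
theorem HasStieltjesIntegral.of_dilate {f : ℝ → A} {r : ℝ} (hr : r ≠ 0)
    (hunit : ∀ t ∈ Icc (0 : ℝ) 1, IsUnit (T (c t))) {I : A}
    (hI : HasStieltjesIntegral (fun t => f t * Ring.inverse (T (x₀ + r • c t) - T x₀))
      (fun t => T (x₀ + r • c t)) I) :
    HasStieltjesIntegral (fun t => f t * Ring.inverse (T (c t))) (T ∘ c) I :=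
  hI.congr fun s hs t _ t' _ => by
    obtain ⟨u, hu⟩ := hunit s hs
    have hinv : Ring.inverse (r • T (c s)) = r⁻¹ • Ring.inverse (T (c s)) := by
      rw [← hu, Ring.inverse_unit]
      exact Ring.inverse_unit (Units.mk0 r hr • u)
    simp only [map_add, map_smul, add_sub_cancel_left, add_sub_add_left_eq_sub, hinv,
      Function.comp_apply, ← smul_sub, mul_assoc, smul_mul_smul_comm, inv_mul_cancel₀ hr, one_smul]

variable [CompleteSpace A]

theorem exists_hasStieltjesIntegral_inverse (hc : BoundedVariationOn c (Icc 0 1))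
    (hc_cont : ContinuousOn c (Icc 0 1)) (hc₀₁ : c 0 = c 1)
    (hunit : ∀ t ∈ Icc (0 : ℝ) 1, IsUnit (T (c t))) :
    ∃ lam, HasStieltjesIntegral (fun t => Ring.inverse (T (c t))) (T ∘ c) lam := by
  have hone : HasDirectionalDerivOn T univ (fun _ => (1 : A)) 0 := fun x _ h => by
    simpa using (hasFDerivAt_const (1 : A) x).hasLineDerivAt h
  obtain ⟨lam, hlam, -⟩ := exists_hasStieltjesIntegral_of_closedHomotopicIn
    (isOpen_regularSet (x₀ := 0) isOpen_univ) (continuousOn_mul_inverse continuousOn_const)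
    hone.mul_inverse hc hc
    ⟨fun p => c p.2, hc_cont.comp continuousOn_snd fun _ hp => hp.2,
      fun p hp => ⟨mem_univ _, by simpa using hunit _ hp.2⟩, fun _ _ => rfl, fun _ _ => rfl,
      fun _ _ => hc₀₁⟩
  exact ⟨lam, by simpa [Function.comp_def] using hlam⟩

theorem eq_mul_of_forall_hasStieltjesIntegral (hΦ : ContinuousOn Φ Ω)
    (hc : BoundedVariationOn c (Icc 0 1)) (hc_cont : ContinuousOn c (Icc 0 1))
    (hcone : ∀ s ∈ Icc (0 : ℝ) 1, ∀ t ∈ Icc (0 : ℝ) 1, x₀ + s • c t ∈ Ω)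
    (hunit : ∀ t ∈ Icc (0 : ℝ) 1, IsUnit (T (c t))) {lam I : A}
    (hlam : HasStieltjesIntegral (fun t => Ring.inverse (T (c t))) (T ∘ c) lam)
    (hI : ∀ r ∈ Ioc (0 : ℝ) 1, HasStieltjesIntegral
      (fun t => Φ (x₀ + r • c t) * Ring.inverse (T (c t))) (T ∘ c) I) :
    I = lam * Φ x₀ := by
  have hcont : ContinuousOn
      (Function.uncurry fun r t => Φ (x₀ + r • c t) * Ring.inverse (T (c t)))
      (Icc (0 : ℝ) 1 ×ˢ Icc (0 : ℝ) 1) := by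
    have hc₂ : ContinuousOn (fun p : ℝ × ℝ => c p.2) (Icc (0 : ℝ) 1 ×ˢ Icc (0 : ℝ) 1) :=
      hc_cont.comp continuousOn_snd fun _ hp => hp.2
    exact (hΦ.comp (continuousOn_const.add (continuousOn_fst.smul hc₂)) fun p hp =>
      hcone _ hp.1 _ hp.2).mul (continuousOn_ringInverse (T.continuous.comp_continuousOn hc₂)
        fun p hp => hunit _ hp.2)
  have hunif : TendstoUniformlyOn (fun r t => Φ (x₀ + r • c t) * Ring.inverse (T (c t)))
      (fun t => Φ x₀ * Ring.inverse (T (c t))) (𝓝[Ioc 0 1] (0 : ℝ)) (Icc 0 1) := fun u hu => by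
    obtain ⟨v, hv, hvu⟩ := isCompact_Icc.mem_uniformity_of_prod hcont
      (left_mem_Icc.2 zero_le_one) (symm_le_uniformity hu)
    filter_upwards [nhdsWithin_mono 0 Ioc_subset_Icc_self hv] with r hr t ht
    simpa using hvu r hr t ht
  have : (𝓝[Ioc 0 1] (0 : ℝ)).NeBot := left_nhdsWithin_Ioc_neBot one_pos
  rw [mul_comm]
  exact tendsto_nhds_unique tendsto_const_nhds
    (HasStieltjesIntegral.tendsto (eventually_mem_nhdsWithin.mono hI) (hlam.const_mul (Φ x₀))
      (T.lipschitz.comp_boundedVariationOn hc) hunif)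

theorem exists_hasStieltjesIntegral_mul_inverse (hΩ : IsOpen Ω) (hΦ : ContinuousOn Φ Ω)
    (hΦd : HasDirectionalDerivOn T Ω Φ d) (hγ : BoundedVariationOn γ (Icc 0 1))
    (hc : BoundedVariationOn c (Icc 0 1))
    (hcone : ∀ s ∈ Icc (0 : ℝ) 1, ∀ t ∈ Icc (0 : ℝ) 1, x₀ + s • c t ∈ Ω)
    (hγc : ClosedHomotopicIn (regularSet T Ω x₀) γ (fun t => x₀ + c t)) :
    ∃ lam, HasStieltjesIntegral (fun t => Ring.inverse (T (c t))) (T ∘ c) lam ∧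
      HasStieltjesIntegral (fun t => Φ (γ t) * Ring.inverse (T (γ t) - T x₀)) (T ∘ γ)
        (lam * Φ x₀) := by
  have ⟨H, hH, hHU, _, (hH₁ : ∀ t ∈ Icc (0 : ℝ) 1, H (1, t) = x₀ + c t), hclosed⟩ := hγc
  have h₀ : (0 : ℝ) ∈ Icc (0 : ℝ) 1 := left_mem_Icc.2 zero_le_one
  have h₁ : (1 : ℝ) ∈ Icc (0 : ℝ) 1 := right_mem_Icc.2 zero_le_one
  have hc_cont : ContinuousOn c (Icc 0 1) := by
    have hHc : ContinuousOn (fun t => H (1, t) - x₀) (Icc 0 1) :=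
      (hH.comp (by fun_prop) fun t ht => ⟨h₁, ht⟩).sub continuousOn_const
    exact hHc.congr fun t ht => by simp only [hH₁ t ht, add_sub_cancel_left]
  have hc₀₁ : c 0 = c 1 := add_left_cancel (a := x₀) <| by
    rw [← hH₁ 0 h₀, ← hH₁ 1 h₁, hclosed 1 h₁]
  have hunit : ∀ t ∈ Icc (0 : ℝ) 1, IsUnit (T (c t)) := fun t ht => by
    have hreg := (hHU ⟨h₁, ht⟩ : H (1, t) ∈ regularSet T Ω x₀).2
    rwa [hH₁ t ht, map_add, add_sub_cancel_left] at hreg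
  have hinvariance {γ₀ γ₁ : ℝ → Coord k} := exists_hasStieltjesIntegral_of_closedHomotopicIn
    (γ₀ := γ₀) (γ₁ := γ₁) (isOpen_regularSet hΩ) (continuousOn_mul_inverse (x₀ := x₀) hΦ)
    hΦd.mul_inverse
  have hdilate : ∀ r : ℝ, BoundedVariationOn (fun t => x₀ + r • c t) (Icc 0 1) := fun r =>
    (LipschitzWith.of_dist_le' fun x y => by
      rw [dist_add_left, dist_smul₀]).comp_boundedVariationOn (f := fun x => x₀ + r • x) hc
  obtain ⟨lam, hlam⟩ := exists_hasStieltjesIntegral_inverse hc hc_cont hc₀₁ hunit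
  obtain ⟨I, hIγ, hIc⟩ := hinvariance hγ (by simpa using hdilate 1) hγc
  have hI : I = lam * Φ x₀ := eq_mul_of_forall_hasStieltjesIntegral hΦ hc hc_cont hcone hunit hlam
    fun r hr => by
      obtain ⟨J, hJc, hJr⟩ := hinvariance (by simpa using hdilate 1) (hdilate r)
        (closedHomotopicIn_smul hc_cont hc₀₁ hr.2 fun s hs t ht =>
          ⟨hcone s ⟨hr.1.le.trans hs.1, hs.2⟩ t ht, by
            rw [map_add, map_smul, add_sub_cancel_left]
            exact (isUnit_smul_iff (Units.mk0 s (hr.1.trans_le hs.1).ne') _).2 (hunit t ht)⟩)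
      exact (hIc.unique hJc ▸ hJr).of_dilate hr.1.ne' hunit
  exact ⟨lam, hlam, hI ▸ hIγ⟩

end Formula

section Curve

variable {k : ℕ}

theorem circle_eq_add (x₀ a b : Coord k) (ε : ℝ) :
    circle x₀ a b ε = fun t => x₀ + circle 0 a b ε t :=
  funext fun t => by simp only [circle, zero_add]

theorem boundedVariationOn_circle (x₀ a b : Coord k) (ε : ℝ) :
    BoundedVariationOn (circle x₀ a b ε) (Icc 0 1) := by
  have hcirc : ContDiff ℝ 1 (circle x₀ a b ε) := by
    unfold circle
    fun_prop
  simpa using (hcirc.contDiffOn (s := uIcc 0 1)).absolutelyContinuousOnInterval.boundedVariationOn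

theorem norm_circle_zero {a b : Coord k} (hab : Orthonormal ℝ ![a, b]) {ε : ℝ} (hε : 0 ≤ ε)
    (t : ℝ) : ‖circle 0 a b ε t‖ = ε := by
  have ha : ‖a‖ = 1 := hab.1 0
  have hb : ‖b‖ = 1 := hab.1 1
  have hperp : inner ℝ a b = 0 := hab.2 (i := 0) (j := 1) (by decide)
  have hunit : ‖Real.cos (2 * Real.pi * t) • a + Real.sin (2 * Real.pi * t) • b‖ ^ 2 = 1 := by
    rw [norm_add_sq_real, norm_smul, norm_smul, ha, hb, inner_smul_left, inner_smul_right, hperp]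
    simp
  rw [circle, zero_add, norm_smul, (pow_eq_one_iff_of_nonneg (norm_nonneg _) two_ne_zero).1 hunit,
    mul_one, Real.norm_of_nonneg hε]

theorem IsEmbracingCircle.add_smul_circle_mem {A : Type*} [CommRing A] [Algebra ℂ A]
    {e : Fin k → A} {Ω : Set (Coord k)} {x₀ a b : Coord k} {ε : ℝ}
    (hC : IsEmbracingCircle e Ω x₀ a b ε) {s : ℝ} (hs : s ∈ Icc (0 : ℝ) 1) (t : ℝ) :
    x₀ + s • circle 0 a b ε t ∈ Ω := by
  refine hC.disc_subset ⟨?_, ?_⟩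
  · rw [add_sub_cancel_left, circle, zero_add]
    exact Submodule.smul_mem _ _ (Submodule.smul_mem _ _
      (Submodule.mem_span_pair.2 ⟨_, _, rfl⟩))
  · rw [add_sub_cancel_left, norm_smul, norm_circle_zero hC.orthonormal hC.radius_pos.le,
      Real.norm_of_nonneg hs.1]
    exact mul_le_of_le_one_left hC.radius_pos.le hs.2

end Curve

section Algebra

variable {A : Type*} [NormedCommRing A] [NormedAlgebra ℂ A] {k : ℕ} {e : Fin k → A}
  {Ω : Set (Coord k)}

/-- The parametrization `point e` of `E_k` as a continuous linear map, the form in which the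
integration theory over normed spaces applies to it. -/
noncomputable def pointL (e : Fin k → A) : Coord k →L[ℝ] A :=
  LinearMap.toContinuousLinearMap
    { toFun := point e
      map_add' := fun x y => by simp [point, add_smul, Finset.sum_add_distrib]
      map_smul' := fun c x => by simp [point, mul_smul, Finset.smul_sum] }

theorem coe_pointL (e : Fin k → A) : ⇑(pointL e) = point e := rfl

theorem Monogenic.exists_hasDirectionalDerivOn {Φ : Coord k → A} (hΦ : Monogenic e Ω Φ) :
    ∃ d, HasDirectionalDerivOn (pointL e) Ω Φ d := by
  have hright := hΦ.2
  choose! d hd using hright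
  refine ⟨d, fun x hx h => ?_⟩
  rw [HasLineDerivAt, hasDerivAt_iff_tendsto_slope_zero, ← Iio_union_Ioi, nhdsWithin_union,
    tendsto_sup]
  simp only [zero_add, zero_smul, add_zero]
  refine ⟨?_, hd x hx h⟩
  -- The left derivative in the direction `h` is minus the right derivative in the direction `-h`.
  have hneg : Tendsto (fun t : ℝ => -t) (𝓝[<] 0) (𝓝[>] 0) := by
    simpa using tendsto_neg_nhdsLT (a := (0 : ℝ))
  have hleft := ((hd x hx (-h)).comp hneg).neg
  rw [← coe_pointL, map_neg, neg_mul, neg_neg] at hleft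
  exact hleft.congr fun t => by simp [inv_neg]

theorem HasCurveIntegral.of_hasStieltjesIntegral {γ : ℝ → Coord k} {Ψ : Coord k → A} {I : A}
    (hI : HasStieltjesIntegral (Ψ ∘ γ) (point e ∘ γ) I) : HasCurveIntegral e γ Ψ I :=
  fun _ hU =>
    have ⟨δ, hδ, hmesh⟩ := TaggedPartition.hasBasis_fine.mem_iff.1 (hI hU)
    ⟨δ, hδ, fun N t τ ht₀ ht₁ ht => @hmesh
      ⟨N, t, τ, ht₀, ht₁, fun i hi => (ht i hi).1, fun i hi => (ht i hi).2.1⟩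
      fun i hi => (ht i hi).2.2⟩

variable [CompleteSpace A]

theorem isUnit_of_forall_algHom_ne_zero {a : A} (ha : ∀ f : A →ₐ[ℂ] ℂ, f a ≠ 0) : IsUnit a := by
  by_contra hunit
  obtain ⟨f, hf⟩ := WeakDual.CharacterSpace.exists_apply_eq_zero hunit
  exact ha (WeakDual.CharacterSpace.toAlgHom f) hf

theorem sdiff_singularSet_subset_regularSet {x₀ : Coord k} :
    Ω \ singularSet e x₀ ⊆ regularSet (pointL e) Ω x₀ := fun _ hx =>
  ⟨hx.1, isUnit_of_forall_algHom_ne_zero fun f hf => hx.2 ⟨f, hf⟩⟩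

end Algebra

section FiniteDimensional

theorem topology_eq_moduleTopology (𝕜 V : Type*) [NontriviallyNormedField 𝕜] [CompleteSpace 𝕜]
    [AddCommGroup V] [Module 𝕜 V] [FiniteDimensional 𝕜 V] [τ : TopologicalSpace V]
    [IsTopologicalAddGroup V] [ContinuousSMul 𝕜 V] [T2Space V] : τ = moduleTopology 𝕜 V :=
  isModuleTopologyOfFiniteDimensional.eq_moduleTopology'

variable (A : Type*) [CommRing A] [Algebra ℂ A] [Module.Finite ℂ A]

/-- The norm on a finite-dimensional commutative algebra for which the norm of an element is the
operator norm, in some basis and for the supremum norm, of the multiplication by it. It serves to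
apply the theory of Banach algebras. -/
noncomputable abbrev leftMulNormedCommRing : NormedCommRing A :=
  letI := Matrix.linftyOpNormedRing (n := Fin (Module.finrank ℂ A)) (α := ℂ)
  NormedCommRing.induced A _ (Algebra.leftMulMatrix (Module.finBasis ℂ A))
    (Algebra.leftMulMatrix_injective _)

/-- `A` with the norm `leftMulNormedCommRing` is a normed algebra. -/
noncomputable abbrev leftMulNormedAlgebra :
    letI := leftMulNormedCommRing A
    NormedAlgebra ℂ A :=
  letI := Matrix.linftyOpNormedRing (n := Fin (Module.finrank ℂ A)) (α := ℂ)
  letI := Matrix.linftyOpNormedAlgebra (R := ℂ) (n := Fin (Module.finrank ℂ A)) (α := ℂ)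
  letI := leftMulNormedCommRing A
  NormedAlgebra.induced ℂ A _ (Algebra.leftMulMatrix (Module.finBasis ℂ A))

theorem eq_topology_leftMulNormedCommRing [τ : TopologicalSpace A] [IsTopologicalAddGroup A]
    [ContinuousSMul ℂ A] [T2Space A] :
    τ = (leftMulNormedCommRing A).toPseudoMetricSpace.toUniformSpace.toTopologicalSpace := by
  let := leftMulNormedCommRing A
  let := leftMulNormedAlgebra A
  exact (topology_eq_moduleTopology ℂ A).trans
    (topology_eq_moduleTopology (τ := PseudoMetricSpace.toUniformSpace.toTopologicalSpace) ℂ A).symm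

end FiniteDimensional

end CauchyFormula

open CauchyFormula in
theorem theorem4_general {A : Type*} [NormedCommRing A] [NormedAlgebra ℂ A] [CompleteSpace A]
    {k : ℕ} {e : Fin k → A} {Ω : Set (Coord k)} (hΩ : IsOpen Ω) {Φ : Coord k → A}
    (hΦ : Monogenic e Ω Φ) {x₀ : Coord k} {γ c : ℝ → Coord k}
    (hγ : BoundedVariationOn γ (Icc 0 1)) (hc : BoundedVariationOn c (Icc 0 1))
    (hcone : ∀ s ∈ Icc (0 : ℝ) 1, ∀ t ∈ Icc (0 : ℝ) 1, x₀ + s • c t ∈ Ω)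
    (hγc : ClosedHomotopicIn (Ω \ singularSet e x₀) γ (fun t => x₀ + c t)) :
    ∃ lam : A,
      HasCurveIntegral e c (fun x => Ring.inverse (point e x)) lam ∧
      HasCurveIntegral e γ
        (fun x => Φ x * Ring.inverse (point e x - point e x₀)) (lam * Φ x₀) := by
  obtain ⟨d, hd⟩ := hΦ.exists_hasDirectionalDerivOn
  obtain ⟨lam, hlam, hI⟩ := exists_hasStieltjesIntegral_mul_inverse hΩ hΦ.1 hd hγ hc hcone
    (hγc.mono sdiff_singularSet_subset_regularSet)
  rw [coe_pointL] at hlam hI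
  exact ⟨lam, .of_hasStieltjesIntegral hlam, .of_hasStieltjesIntegral hI⟩

open CauchyFormula in
theorem theorem4 {A : Type*} [CommRing A] [Algebra ℂ A] [Module.Finite ℂ A]
    [TopologicalSpace A] [IsTopologicalAddGroup A] [ContinuousSMul ℂ A] [T2Space A]
    {k : ℕ} (hk : 2 ≤ k) (e : Fin k → A) (he : LinearIndependent ℝ e)
    (he₁ : e ⟨0, by omega⟩ = 1)
    (hsurj : ∀ f : A →ₐ[ℂ] ℂ, Function.Surjective fun x : Coord k => f (point e x))
    (Ω : Set (Coord k)) (hΩ_open : IsOpen Ω) (hΩ_conn : IsConnected Ω)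
    (hΩ_convex : ConvexAlongDirections e Ω)
    (Φ : Coord k → A) (hΦ : Monogenic e Ω Φ)
    (x₀ : Coord k) (hx₀ : x₀ ∈ Ω)
    (γ : ℝ → Coord k) (hγ : IsClosedRectifiableJordan γ)
    (a b : Coord k) (ε : ℝ) (hC : IsEmbracingCircle e Ω x₀ a b ε)
    (hγC : ClosedHomotopicIn (Ω \ singularSet e x₀) γ (circle x₀ a b ε)) :
    ∃ lam : A,
      HasCurveIntegral e (circle 0 a b ε) (fun x => Ring.inverse (point e x)) lam ∧
      HasCurveIntegral e γ
        (fun x => Φ x * Ring.inverse (point e x - point e x₀)) (lam * Φ x₀) := by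
  let := leftMulNormedCommRing A
  let := leftMulNormedAlgebra A
  obtain rfl := eq_topology_leftMulNormedCommRing A
  have : CompleteSpace A := FiniteDimensional.complete ℂ A
  rw [circle_eq_add] at hγC
  exact theorem4_general hΩ_open hΦ hγ.rectifiable (boundedVariationOn_circle 0 a b ε)
    (fun s hs t _ => hC.add_smul_circle_mem hs t) hγC
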